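/- Let $E=(E^0,E^1,r,s)$ be a directed graph with $E^0\neq\emptyset$ and $E^0,E^1$ countable, which is row-finite without sources ($r^{-1}(v)$ is finite and non-empty for every $v\in E^0$). Let $G$ be a countable group acting on $E$ by graph automorphisms, and let $\varphi\colon G\times E^1\to G$ satisfy $\varphi(gh,e)=\varphi(g,h\cdot e)\varphi(h,e)$ and $\varphi(g,e)\cdot v=g\cdot v$ for all $g,h\in G$, $e\in E^1$, $v\in E^0$. Let $R$ be a commutative ring with unit and involution. Let $L_R(G,E)$ be the Exel–Pardo $*$-algebra, i.e. the universal (not necessarily unital) $*$-algebra over $R$ generated by elements $p_{v,f},s_{e,g}$ ($v\in E^0$, $e\in E^1$, $f,g\in G$) such that, with $1$ the unit of $G$, (a) the $p_{v,1}$ are mutually orthogonal projections and the $s_{e,1}$ are partial isometries, with $s_{e,1}^*s_{f,1}=\delta_{e,f}p_{s(e),1}$ and $p_{v,1}=\sum_{r(e)=v}s_{e,1}s_{e,1}^*$; (b) $p_{v,f}^*=p_{f^{-1}\cdot v,f^{-1}}$; (c) $p_{v,f}p_{w,h}=\delta_{v,f\cdot w}p_{v,fh}$; (d) $p_{v,f}s_{e,g}=\delta_{v,r(f\cdot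 e)}s_{f\cdot e,\varphi(f,e)g}$; (e) $s_{e,g}p_{v,f}=\delta_{g\cdot v,s(e)}s_{e,gf}$. Finite paths are the vertices $v$ (length $0$, $r(v)=s(v)=v$) and the sequences $\alpha=\alpha_1\cdots\alpha_n$ of edges with $s(\alpha_i)=r(\alpha_{i+1})$, with $r(\alpha)=r(\alpha_1)$ and $s(\alpha)=s(\alpha_n)$; infinite paths are defined likewise. The action and $\varphi$ extend to paths by $\varphi(g,v)=g$, $g\cdot(e\beta)=(g\cdot e)(\varphi(g,e)\cdot\beta)$ and $\varphi(g,e\beta)=\varphi(\varphi(g,e),\beta)$, and the action extends to infinite paths through initial segments. A finite path $\alpha$ is strongly fixed by $g$ if $g\cdot\alpha=\alpha$ and $\varphi(g,\alpha)=1$, and is a minimal strongly fixed path for $g$ if moreover no proper initial segment of $\alpha$ is strongly fixed by $g$. Let $Z(v)$ be the set of infinite paths with range $v$. Suppose that for every $g\in G$ and every $v\in E^0$ there are at most finitely many minimal strongly fixed paths for $g$ with range $v$. Then the ring $L_R(G,E)$ is simple if and only if the ring $R$ is simple and 1. $E$ is weakly $G$-transitive: for every infinite path $\xi$ and every vertex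 $v$ there are a vertex $u$ on $\xi$, an element $g\in G$ and a finite path $\alpha$ with $r(\alpha)=v$ and $s(\alpha)=g\cdot u$; 2. every $G$-circuit has an entry: whenever $g\in G$ and $\gamma=\gamma_1\cdots\gamma_n$ is a path of length $n\ge 1$ with $s(\gamma)=g\cdot r(\gamma)$, there are an $i$ and an edge $f\neq\gamma_i$ with $r(f)=r(\gamma_i)$; and 3. for every vertex $v$, every $g\in G$ that fixes $Z(v)$ pointwise is slack at $v$: there is an $n\ge 0$ such that all finite paths with range $v$ and length at least $n$ are strongly fixed by $g$. (A ring is simple if it is non-zero and has no two-sided ideals other than $0$ and itself.) -/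

import Mathlib

namespace ExelPardo

universe u v w x

/-- The data `(G, E, σ, φ)` on a directed graph with vertex set `V` and edge set `E`, range map `r`
and source map `s`: the graph is row-finite without sources, `G` acts on it by graph automorphisms
(through the two `MulAction` instances), and `φ` is a one-cocycle for the action on edges
such that `φ(g, e)` and `g` act in the same way on vertices. -/
structure SelfSimilarGraph (G : Type u) (V : Type v) (E : Type w)
    [Group G] [MulAction G V] [MulAction G E] where
  r : E → V
  s : E → V
  finite_range_fiber : ∀ v : V, {e : E | r e = v}.Finite
  no_sources : ∀ v : V, ∃ e : E, r e = v
  r_smul : ∀ (g : G) (e : E), r (g • e) = g • r e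
  s_smul : ∀ (g : G) (e : E), s (g • e) = g • s e
  φ : G → E → G
  φ_mul : ∀ (g h : G) (e : E), φ (g * h) e = φ g (h • e) * φ h e
  φ_smul_vertex : ∀ (g : G) (e : E) (v : V), φ g e • v = g • v

variable {G : Type u} {V : Type v} {E : Type w} [Group G] [MulAction G V] [MulAction G E]

namespace SelfSimilarGraph

variable (Γ : SelfSimilarGraph G V E)

/-! ### Finite paths -/

/-- `e₁ e₂ … eₙ` is a path with range `v`: `v = r(e₁)` and `s(eᵢ) = r(eᵢ₊₁)`.
The empty list represents the vertex `v`, a path of length `0`. -/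
def IsPathFrom : V → List E → Prop
  | _, [] => True
  | v, e :: l => Γ.r e = v ∧ IsPathFrom (Γ.s e) l

/-- The source of the path `e₁ … eₙ` with range `v`. -/
def sourceFrom : V → List E → V
  | v, [] => v
  | _, e :: l => sourceFrom (Γ.s e) l

/-- `φ(g, e₁ … eₙ)`, given by `φ(g, v) = g` and `φ(g, e β) = φ(φ(g, e), β)`. -/
def cocycleList : G → List E → G
  | g, [] => g
  | g, e :: l => cocycleList (Γ.φ g e) l

/-- The edges of `g · (e₁ … eₙ)`, given by `g · (e β) = (g · e) (φ(g, e) · β)`. -/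
def actList : G → List E → List E
  | _, [] => []
  | g, e :: l => (g • e) :: actList (Γ.φ g e) l

theorem isPathFrom_actList (g : G) (v : V) (l : List E) (h : Γ.IsPathFrom v l) :
    Γ.IsPathFrom (g • v) (Γ.actList g l) := by
  induction l generalizing g v with
  | nil => trivial
  | cons e l ih =>
    refine ⟨by rw [Γ.r_smul, h.1], ?_⟩
    rw [Γ.s_smul, ← Γ.φ_smul_vertex g e]
    exact ih _ _ h.2

/-- The set `E*` of finite paths, including the vertices as paths of length `0`. -/
structure FinPath where
  range : V
  edges : List E
  isPath : Γ.IsPathFrom range edges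

namespace FinPath

variable {Γ}

/-- The source `s(α)`. -/
def source (α : Γ.FinPath) : V := Γ.sourceFrom α.range α.edges

/-- The length `|α|`. -/
def length (α : Γ.FinPath) : ℕ := α.edges.length

/-- The path `g · α`. -/
def act (g : G) (α : Γ.FinPath) : Γ.FinPath where
  range := g • α.range
  edges := Γ.actList g α.edges
  isPath := Γ.isPathFrom_actList g α.range α.edges α.isPath

/-- The group element `φ(g, α)`. -/
def cocycle (g : G) (α : Γ.FinPath) : G := Γ.cocycleList g α.edges

/-- `α` is a prefix (initial segment) of `β`, possibly equal to `β`, possibly of length `0`. -/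
def IsPrefix (α β : Γ.FinPath) : Prop := α.range = β.range ∧ α.edges <+: β.edges

/-- `α` is strongly fixed by `g`: `g · α = α` and `φ(g, α) = 1`. -/
def StronglyFixedBy (α : Γ.FinPath) (g : G) : Prop := α.act g = α ∧ α.cocycle g = 1

/-- `α` is strongly fixed by `g` and no proper prefix of `α` is. -/
def MinimalStronglyFixedBy (α : Γ.FinPath) (g : G) : Prop :=
  α.StronglyFixedBy g ∧ ∀ β : Γ.FinPath, β.IsPrefix α → β ≠ α → ¬ β.StronglyFixedBy g

end FinPath

/-! ### Infinite paths -/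

/-- The set `E^∞` of infinite paths `e₀ e₁ e₂ …`, where `s(eₙ) = r(eₙ₊₁)`. -/
structure InfPath where
  edge : ℕ → E
  isPath : ∀ n, Γ.s (edge n) = Γ.r (edge (n + 1))

namespace InfPath

variable {Γ}

/-- The range `r(e₀)`. -/
def range (ξ : Γ.InfPath) : V := Γ.r (ξ.edge 0)

/-- `φ(g, e₀ … eₙ₋₁)`. -/
def cocyclePrefix (g : G) (ξ : Γ.InfPath) : ℕ → G
  | 0 => g
  | n + 1 => Γ.φ (cocyclePrefix g ξ n) (ξ.edge n)

/-- The infinite path `g · ξ`, whose `n`-th edge is `φ(g, e₀ … eₙ₋₁) · eₙ`. -/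
def act (g : G) (ξ : Γ.InfPath) : Γ.InfPath where
  edge n := ξ.cocyclePrefix g n • ξ.edge n
  isPath n := by
    rw [Γ.s_smul, Γ.r_smul, cocyclePrefix, Γ.φ_smul_vertex, ξ.isPath n]

end InfPath

/-- The cylinder set `Z(v)` of infinite paths with range `v`. -/
def cylinder (v : V) : Set Γ.InfPath := {ξ | ξ.range = v}

/-! ### The graph conditions -/

/-- For all `g` and `v` there are at most finitely many minimal strongly fixed paths for `g` with
range `v`. -/
def FinitelyManyMinimalStronglyFixed : Prop :=
  ∀ (g : G) (v : V), {α : Γ.FinPath | α.range = v ∧ α.MinimalStronglyFixedBy g}.Finite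

/-- Weak `G`-transitivity: for every infinite path `ξ` and every vertex `v` there is a
vertex `u` along `ξ` such that some finite path has range `v` and source in the orbit of `u`. -/
def WeaklyTransitive : Prop :=
  ∀ (ξ : Γ.InfPath) (v : V), ∃ (n : ℕ) (g : G) (α : Γ.FinPath),
    α.range = v ∧ α.source = g • Γ.r (ξ.edge n)

/-- `(g, γ)` is a `G`-circuit: `γ` has nonzero length and `s(γ) = g · r(γ)`. -/
def IsCircuit (g : G) (γ : Γ.FinPath) : Prop := 0 < γ.length ∧ γ.source = g • γ.range

/-- `γ = γ₁ … γₙ` has an entry: for some `i` there is an edge other than `γᵢ` with range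
`r(γᵢ)`. -/
def HasEntry (γ : Γ.FinPath) : Prop := ∃ e ∈ γ.edges, ∃ f : E, f ≠ e ∧ Γ.r f = Γ.r e

/-- Every `G`-circuit has an entry. -/
def EveryCircuitHasEntry : Prop := ∀ (g : G) (γ : Γ.FinPath), Γ.IsCircuit g γ → Γ.HasEntry γ

/-- `g` is slack at `v`: all sufficiently long finite paths with range `v` are strongly fixed
by `g`. -/
def SlackAt (g : G) (v : V) : Prop :=
  ∃ n : ℕ, ∀ α : Γ.FinPath, α.range = v → n ≤ α.length → α.StronglyFixedBy g

/-- `g` fixes `Z(v)` pointwise. -/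
def FixesCylinder (g : G) (v : V) : Prop := ∀ ξ ∈ Γ.cylinder v, ξ.act g = ξ

/-! ### `(G, E)`-families -/

open Classical in
/-- `GERel Γ P S a b` says that `a = b` is one of the defining relations of a `(G, E)`-family
`{P v f} ∪ {S e g}` in a `*`-algebra `A`. -/
inductive GERel {A : Type x} [NonUnitalRing A] [StarRing A] (P : V → G → A) (S : E → G → A) :
    A → A → Prop
  -- the `P v 1` and `S e 1` form an `E`-family
  | proj_star (v : V) : GERel P S (star (P v 1)) (P v 1)
  | proj_idem (v : V) : GERel P S (P v 1 * P v 1) (P v 1)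
  | proj_orth (v w : V) (h : v ≠ w) : GERel P S (P v 1 * P w 1) 0
  | partial_isometry (e : E) : GERel P S (S e 1 * star (S e 1) * S e 1) (S e 1)
  | star_mul_edge (e f : E) : GERel P S (star (S e 1) * S f 1) (if e = f then P (Γ.s e) 1 else 0)
  | vertex_sum (v : V) : GERel P S (P v 1)
      (∑ e ∈ (Γ.finite_range_fiber v).toFinset, S e 1 * star (S e 1))
  -- the relations involving the group
  | star_vertex (v : V) (f : G) : GERel P S (star (P v f)) (P (f⁻¹ • v) f⁻¹)
  | vertex_vertex (v w : V) (f h : G) :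
      GERel P S (P v f * P w h) (if v = f • w then P v (f * h) else 0)
  | vertex_edge (v : V) (e : E) (f g : G) :
      GERel P S (P v f * S e g) (if v = Γ.r (f • e) then S (f • e) (Γ.φ f e * g) else 0)
  | edge_vertex (e : E) (v : V) (g f : G) :
      GERel P S (S e g * P v f) (if g • v = Γ.s e then S e (g * f) else 0)

/-- `{P v f} ∪ {S e g}` is a `(G, E)`-family in the `*`-algebra `A`. -/
def IsGEFamily {A : Type x} [NonUnitalRing A] [StarRing A] (P : V → G → A) (S : E → G → A) :
    Prop :=
  ∀ a b : A, Γ.GERel P S a b → a = b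

end SelfSimilarGraph

/-! ### The free `*`-algebra on the symbols `P v f`, `S e g` -/

/-- The alphabet: the symbols `P v f`, `S e g` and their formal adjoints. -/
inductive Symb (G : Type u) (V : Type v) (E : Type w) : Type (max u v w)
  | P (v : V) (f : G)
  | S (e : E) (g : G)
  | Pstar (v : V) (f : G)
  | Sstar (e : E) (g : G)

/-- The formal adjoint of a symbol. -/
def Symb.adj {G : Type u} {V : Type v} {E : Type w} : Symb G V E → Symb G V E
  | .P v f => .Pstar v f
  | .S e g => .Sstar e g
  | .Pstar v f => .P v f
  | .Sstar e g => .S e g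

theorem Symb.adj_adj {G : Type u} {V : Type v} {E : Type w} (y : Symb G V E) :
    y.adj.adj = y := by
  cases y <;> rfl

/-- The nonempty finite words in the alphabet. -/
abbrev Word (G : Type u) (V : Type v) (E : Type w) := FreeSemigroup (Symb G V E)

/-- `(x₁ x₂ … xₙ)* = xₙ* … x₂* x₁*`. -/
def Word.adj {G : Type u} {V : Type v} {E : Type w} (y : Word G V E) : Word G V E :=
  (FreeSemigroup.lift (fun a : Symb G V E => MulOpposite.op (FreeSemigroup.of a.adj)) y).unop

section Word

variable {G : Type u} {V : Type v} {E : Type w}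

theorem Word.adj_of (a : Symb G V E) :
    Word.adj (FreeSemigroup.of a) = FreeSemigroup.of a.adj := rfl

theorem Word.adj_mul (y z : Word G V E) : Word.adj (y * z) = Word.adj z * Word.adj y := by
  simp [Word.adj]

theorem Word.adj_adj (y : Word G V E) : Word.adj (Word.adj y) = y := by
  induction y using FreeSemigroup.recOnMul with
  | ih1 a => rw [Word.adj_of, Word.adj_of, Symb.adj_adj]
  | ih2 a y ha hy => rw [Word.adj_mul, Word.adj_mul, ha, hy]

end Word

/-- The free `R`-module on the words, with the product extending concatenation. -/
abbrev FreeStarAlg (R : Type x) [CommRing R] (G : Type u) (V : Type v) (E : Type w) :=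
  MonoidAlgebra R (Word G V E)

section Free

variable {R : Type x} [CommRing R] [StarRing R] {G : Type u} {V : Type v} {E : Type w}

/-- `(∑ r_y y)* = ∑ r_y* y*`. -/
noncomputable def freeStar : FreeStarAlg R G V E →+ FreeStarAlg R G V E :=
  (Finsupp.liftAddHom fun y : Word G V E =>
    (MonoidAlgebra.singleAddHom (Word.adj y)).comp (starAddEquiv (R := R)).toAddMonoidHom).comp
    MonoidAlgebra.coeffAddEquiv.toAddMonoidHom

theorem freeStar_single (y : Word G V E) (r : R) :
    freeStar (MonoidAlgebra.single y r) = MonoidAlgebra.single (Word.adj y) (star r) := by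
  simp [freeStar]

theorem freeStar_freeStar (a : FreeStarAlg R G V E) : freeStar (freeStar a) = a := by
  induction a using MonoidAlgebra.induction_linear with
  | zero => simp
  | add a b ha hb => simp [ha, hb]
  | single y r => simp [freeStar_single, Word.adj_adj]

theorem freeStar_mul (a b : FreeStarAlg R G V E) :
    freeStar (a * b) = freeStar b * freeStar a := by
  induction a using MonoidAlgebra.induction_linear with
  | zero => simp
  | add a a' ha ha' => simp [add_mul, mul_add, ha, ha']
  | single y r =>
    induction b using MonoidAlgebra.induction_linear with
    | zero => simp
    | add b b' hb hb' => simp [add_mul, mul_add, hb, hb']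
    | single z t =>
      simp [freeStar_single, MonoidAlgebra.single_mul_single, Word.adj_mul, mul_comm]

theorem freeStar_smul (c : R) (a : FreeStarAlg R G V E) :
    freeStar (c • a) = star c • freeStar a := by
  induction a using MonoidAlgebra.induction_linear with
  | zero => simp
  | add a b ha hb => simp [smul_add, ha, hb]
  | single y r => simp [freeStar_single]

noncomputable instance : StarRing (FreeStarAlg R G V E) where
  star a := freeStar a
  star_involutive := freeStar_freeStar
  star_mul := freeStar_mul
  star_add := map_add freeStar

end Free

/-! ### The Exel--Pardo `*`-algebra -/

section Algebra

variable (R : Type x) [CommRing R] [StarRing R] (Γ : SelfSimilarGraph G V E)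

/-- The letter `P v f` in the free `*`-algebra. -/
noncomputable def freeP (v : V) (f : G) : FreeStarAlg R G V E :=
  MonoidAlgebra.single (FreeSemigroup.of (Symb.P v f)) 1

/-- The letter `S e g` in the free `*`-algebra. -/
noncomputable def freeS (e : E) (g : G) : FreeStarAlg R G V E :=
  MonoidAlgebra.single (FreeSemigroup.of (Symb.S e g)) 1

/-- The scalar multiples of the relators of a `(G, E)`-family and of their adjoints. -/
def relators : Set (FreeStarAlg R G V E) :=
  {y | ∃ (c : R) (a b : FreeStarAlg R G V E), Γ.GERel (freeP R) (freeS R) a b ∧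
    (y = c • (a - b) ∨ y = c • star (a - b))}

/-- The two-sided algebra ideal generated by the relators and their adjoints. -/
noncomputable def relatorIdeal : TwoSidedIdeal (FreeStarAlg R G V E) := TwoSidedIdeal.span (relators R Γ)

theorem smul_mem_relatorIdeal (c : R) {a : FreeStarAlg R G V E} (ha : a ∈ relatorIdeal R Γ) :
    c • a ∈ relatorIdeal R Γ := by
  induction ha using TwoSidedIdeal.span_induction with
  | mem y hy =>
    obtain ⟨d, a, b, h, rfl | rfl⟩ := hy
    · exact TwoSidedIdeal.subset_span ⟨c * d, a, b, h, .inl (smul_smul _ _ _)⟩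
    · exact TwoSidedIdeal.subset_span ⟨c * d, a, b, h, .inr (smul_smul _ _ _)⟩
  | zero => rw [smul_zero]; exact TwoSidedIdeal.zero_mem _
  | add a b _ _ ha hb => rw [smul_add]; exact TwoSidedIdeal.add_mem _ ha hb
  | neg a _ ha => rw [smul_neg]; exact TwoSidedIdeal.neg_mem _ ha
  | left_absorb b a _ ha => rw [← mul_smul_comm]; exact TwoSidedIdeal.mul_mem_left _ _ _ ha
  | right_absorb b a _ ha => rw [← smul_mul_assoc]; exact TwoSidedIdeal.mul_mem_right _ _ _ ha

theorem star_mem_relatorIdeal {a : FreeStarAlg R G V E} (ha : a ∈ relatorIdeal R Γ) :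
    star a ∈ relatorIdeal R Γ := by
  induction ha using TwoSidedIdeal.span_induction with
  | mem y hy =>
    obtain ⟨d, a, b, h, rfl | rfl⟩ := hy
    · exact TwoSidedIdeal.subset_span ⟨star d, a, b, h, .inr (freeStar_smul _ _)⟩
    · exact TwoSidedIdeal.subset_span
        ⟨star d, a, b, h, .inl ((freeStar_smul _ _).trans (congrArg _ (star_star (a - b))))⟩
  | zero => rw [star_zero]; exact TwoSidedIdeal.zero_mem _
  | add a b _ _ ha hb => rw [star_add]; exact TwoSidedIdeal.add_mem _ ha hb
  | neg a _ ha => rw [star_neg]; exact TwoSidedIdeal.neg_mem _ ha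
  | left_absorb b a _ ha => rw [star_mul]; exact TwoSidedIdeal.mul_mem_right _ _ _ ha
  | right_absorb b a _ ha => rw [star_mul]; exact TwoSidedIdeal.mul_mem_left _ _ _ ha

/-- The Exel--Pardo `*`-algebra `L_R(G, E)`. -/
def ExelPardoAlgebra : Type (max u v w x) := (relatorIdeal R Γ).ringCon.Quotient

namespace ExelPardoAlgebra

noncomputable instance : NonUnitalRing (ExelPardoAlgebra R Γ) :=
  inferInstanceAs (NonUnitalRing (relatorIdeal R Γ).ringCon.Quotient)

/-- The quotient map from the free `*`-algebra. -/
noncomputable def mk (a : FreeStarAlg R G V E) : ExelPardoAlgebra R Γ := ((a : (relatorIdeal R Γ).ringCon.Quotient))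

variable {R Γ}

theorem mk_surjective : Function.Surjective (mk R Γ) := Quotient.mk''_surjective

theorem mk_eq_mk {a b : FreeStarAlg R G V E} : mk R Γ a = mk R Γ b ↔ a - b ∈ relatorIdeal R Γ :=
  (RingCon.eq _).trans (TwoSidedIdeal.rel_iff _ _ _)

theorem mk_add (a b : FreeStarAlg R G V E) : mk R Γ (a + b) = mk R Γ a + mk R Γ b := rfl
theorem mk_mul (a b : FreeStarAlg R G V E) : mk R Γ (a * b) = mk R Γ a * mk R Γ b := rfl
theorem mk_zero : mk R Γ 0 = 0 := rfl

noncomputable instance : SMul R (ExelPardoAlgebra R Γ) where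
  smul c := Quotient.map' (fun a => c • a) fun a b h => by
    have h' := smul_mem_relatorIdeal R Γ c ((TwoSidedIdeal.rel_iff _ a b).1 h)
    rw [smul_sub] at h'
    exact (TwoSidedIdeal.rel_iff _ _ _).2 h'

noncomputable instance : Star (ExelPardoAlgebra R Γ) where
  star := Quotient.map' (fun a => star a) fun a b h => by
    have h' := star_mem_relatorIdeal R Γ ((TwoSidedIdeal.rel_iff _ a b).1 h)
    rw [star_sub] at h'
    exact (TwoSidedIdeal.rel_iff _ _ _).2 h'

theorem mk_smul (c : R) (a : FreeStarAlg R G V E) : mk R Γ (c • a) = c • mk R Γ a := rfl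
theorem mk_star (a : FreeStarAlg R G V E) : mk R Γ (star a) = star (mk R Γ a) := rfl

noncomputable instance : Module R (ExelPardoAlgebra R Γ) where
  one_smul a := by
    obtain ⟨a, rfl⟩ := mk_surjective a
    rw [← mk_smul, one_smul]
  mul_smul c d a := by
    obtain ⟨a, rfl⟩ := mk_surjective a
    simp only [← mk_smul, mul_smul]
  smul_zero c := by rw [← mk_zero, ← mk_smul, smul_zero]
  smul_add c a b := by
    obtain ⟨a, rfl⟩ := mk_surjective a
    obtain ⟨b, rfl⟩ := mk_surjective b
    simp only [← mk_smul, ← mk_add, smul_add]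
  add_smul c d a := by
    obtain ⟨a, rfl⟩ := mk_surjective a
    simp only [← mk_smul, ← mk_add, add_smul]
  zero_smul a := by
    obtain ⟨a, rfl⟩ := mk_surjective a
    rw [← mk_smul, zero_smul, mk_zero]

instance : IsScalarTower R (ExelPardoAlgebra R Γ) (ExelPardoAlgebra R Γ) where
  smul_assoc c a b := by
    obtain ⟨a, rfl⟩ := mk_surjective a
    obtain ⟨b, rfl⟩ := mk_surjective b
    simp only [smul_eq_mul, ← mk_smul, ← mk_mul, smul_mul_assoc]

instance : SMulCommClass R (ExelPardoAlgebra R Γ) (ExelPardoAlgebra R Γ) where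
  smul_comm c a b := by
    obtain ⟨a, rfl⟩ := mk_surjective a
    obtain ⟨b, rfl⟩ := mk_surjective b
    simp only [smul_eq_mul, ← mk_smul, ← mk_mul, mul_smul_comm]

noncomputable instance : StarRing (ExelPardoAlgebra R Γ) where
  star_involutive a := by
    obtain ⟨a, rfl⟩ := mk_surjective a
    simp only [← mk_star, star_star]
  star_mul a b := by
    obtain ⟨a, rfl⟩ := mk_surjective a
    obtain ⟨b, rfl⟩ := mk_surjective b
    simp only [← mk_star, ← mk_mul, star_mul]
  star_add a b := by
    obtain ⟨a, rfl⟩ := mk_surjective a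
    obtain ⟨b, rfl⟩ := mk_surjective b
    simp only [← mk_star, ← mk_add, star_add]

instance : StarModule R (ExelPardoAlgebra R Γ) where
  star_smul c a := by
    obtain ⟨a, rfl⟩ := mk_surjective a
    simp only [← mk_star, ← mk_smul]
    exact congrArg _ (freeStar_smul c a)

variable (R Γ)

/-- The generator `p_{v,f}`. -/
noncomputable def p (v : V) (f : G) : ExelPardoAlgebra R Γ := mk R Γ (freeP R v f)

/-- The generator `s_{e,g}`. -/
noncomputable def s (e : E) (g : G) : ExelPardoAlgebra R Γ := mk R Γ (freeS R e g)

open Classical in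
/-- The generators form a `(G, E)`-family. -/
theorem isGEFamily : Γ.IsGEFamily (p R Γ) (s R Γ) := by
  have key : ∀ {a b}, Γ.GERel (freeP R) (freeS R) a b → mk R Γ a = mk R Γ b := fun h =>
    mk_eq_mk.2 (TwoSidedIdeal.subset_span ⟨1, _, _, h, .inl (one_smul _ _).symm⟩)
  have mk_sum : ∀ (t : Finset E) (f : E → FreeStarAlg R G V E),
      mk R Γ (∑ e ∈ t, f e) = ∑ e ∈ t, mk R Γ (f e) := fun t f =>
    map_sum (⟨⟨mk R Γ, mk_zero⟩, mk_add⟩ : FreeStarAlg R G V E →+ ExelPardoAlgebra R Γ) f t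
  rintro _ _ h
  cases h with
  | proj_star v => exact key (.proj_star v)
  | proj_idem v => exact key (.proj_idem v)
  | proj_orth v w h => exact key (.proj_orth v w h)
  | partial_isometry e => exact key (.partial_isometry e)
  | star_mul_edge e f => exact (key (.star_mul_edge e f)).trans (apply_ite _ _ _ _)
  | vertex_sum v => exact (key (.vertex_sum v)).trans (mk_sum _ _)
  | star_vertex v f => exact key (.star_vertex v f)
  | vertex_vertex v w f h => exact (key (.vertex_vertex v w f h)).trans (apply_ite _ _ _ _)
  | vertex_edge v e f g => exact (key (.vertex_edge v e f g)).trans (apply_ite _ _ _ _)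
  | edge_vertex e v g f => exact (key (.edge_vertex e v g f)).trans (apply_ite _ _ _ _)

section Lift

set_option linter.unusedSectionVars false

variable {R Γ} {A : Type*} [NonUnitalRing A] [StarRing A] [Module R A]
  [IsScalarTower R A A] [SMulCommClass R A A] [StarModule R A]

/-- The value of a symbol in a `*`-algebra. -/
def symbVal (P : V → G → A) (S : E → G → A) : Symb G V E → A
  | .P v f => P v f
  | .S e g => S e g
  | .Pstar v f => star (P v f)
  | .Sstar e g => star (S e g)

/-- The extension to the free `*`-algebra. -/
noncomputable def freeLift (P : V → G → A) (S : E → G → A) : FreeStarAlg R G V E →ₙₐ[R] A :=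
  MonoidAlgebra.liftMagma R (FreeSemigroup.lift (symbVal P S))

theorem freeLift_single (P : V → G → A) (S : E → G → A) (y : Word G V E) (r : R) :
    freeLift P S (MonoidAlgebra.single y r) = r • FreeSemigroup.lift (symbVal P S) y := by
  simp [freeLift]

theorem freeLift_star (P : V → G → A) (S : E → G → A) (a : FreeStarAlg R G V E) :
    freeLift P S (star a) = star (freeLift P S a) := by
  change freeLift P S (freeStar a) = _
  have hw : ∀ y : Word G V E, FreeSemigroup.lift (symbVal P S) (Word.adj y) =
      star (FreeSemigroup.lift (symbVal P S) y) := by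
    intro y
    induction y using FreeSemigroup.recOnMul with
    | ih1 a => cases a <;> simp [Word.adj_of, Symb.adj, symbVal]
    | ih2 a y ha hy => rw [Word.adj_mul, map_mul, map_mul, star_mul, ha, hy]
  induction a using MonoidAlgebra.induction_linear with
  | zero => simp
  | add a b ha hb => simp [ha, hb]
  | single y r => simp [freeStar_single, freeLift_single, hw]

theorem freeLift_eq_zero {P : V → G → A} {S : E → G → A} (h : Γ.IsGEFamily P S)
    {a : FreeStarAlg R G V E} (ha : a ∈ relatorIdeal R Γ) : freeLift P S a = 0 := by
  have hP : ∀ v f, freeLift P S (freeP R v f : FreeStarAlg R G V E) = P v f := fun v f => by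
    simp [freeP, freeLift_single, symbVal]
  have hS : ∀ e g, freeLift P S (freeS R e g : FreeStarAlg R G V E) = S e g := fun e g => by
    simp [freeS, freeLift_single, symbVal]
  have key : ∀ a b, Γ.GERel (freeP R) (freeS R) a b → freeLift P S a = freeLift P S b := by
    intro a b hab
    apply h
    cases hab with
    | proj_star v => simpa [freeLift_star, hP] using .proj_star v
    | proj_idem v => simpa [hP] using .proj_idem v
    | proj_orth v w h => simpa [hP] using .proj_orth v w h
    | partial_isometry e => simpa [freeLift_star, hS] using .partial_isometry e
    | star_mul_edge e f =>
      simpa [freeLift_star, hS, hP, apply_ite (freeLift P S)] using .star_mul_edge e f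
    | vertex_sum v => simpa [freeLift_star, hS, hP, map_sum] using .vertex_sum v
    | star_vertex v f => simpa [freeLift_star, hP] using .star_vertex v f
    | vertex_vertex v w f h =>
      simpa [hP, apply_ite (freeLift P S)] using .vertex_vertex v w f h
    | vertex_edge v e f g =>
      simpa [hP, hS, apply_ite (freeLift P S)] using .vertex_edge v e f g
    | edge_vertex e v g f =>
      simpa [hP, hS, apply_ite (freeLift P S)] using .edge_vertex e v g f
  induction ha using TwoSidedIdeal.span_induction with
  | mem y hy =>
    obtain ⟨d, a, b, hab, rfl | rfl⟩ := hy
    · rw [map_smul, map_sub, key a b hab, sub_self, smul_zero]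
    · rw [map_smul, freeLift_star, map_sub, key a b hab, sub_self, star_zero, smul_zero]
  | zero => exact map_zero _
  | add a b _ _ ha hb => rw [map_add, ha, hb, add_zero]
  | neg a _ ha => rw [map_neg, ha, neg_zero]
  | left_absorb b a _ ha => rw [map_mul, ha, mul_zero]
  | right_absorb b a _ ha => rw [map_mul, ha, zero_mul]

/-- The universal property of `L_R(G, E)`. -/
theorem existsUnique_lift (P : V → G → A) (S : E → G → A) (h : Γ.IsGEFamily P S) :
    ∃! π : ExelPardoAlgebra R Γ →⋆ₙₐ[R] A,
      (∀ v f, π (p R Γ v f) = P v f) ∧ ∀ e g, π (s R Γ e g) = S e g := by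
  let π₀ : ExelPardoAlgebra R Γ → A := Quotient.lift (fun a => freeLift P S a) fun a b hab => by
    have := freeLift_eq_zero h ((TwoSidedIdeal.rel_iff _ a b).1 hab)
    rwa [map_sub, sub_eq_zero] at this
  have hπ₀ : ∀ a, π₀ (mk R Γ a) = freeLift P S a := fun _ => rfl
  let π : ExelPardoAlgebra R Γ →⋆ₙₐ[R] A :=
    { toFun := π₀
      map_smul' := fun c a => by
        obtain ⟨a, rfl⟩ := mk_surjective a
        simp [← mk_smul, hπ₀]
      map_zero' := by rw [← mk_zero, hπ₀, map_zero]
      map_add' := fun a b => by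
        obtain ⟨a, rfl⟩ := mk_surjective a
        obtain ⟨b, rfl⟩ := mk_surjective b
        simp [← mk_add, hπ₀]
      map_mul' := fun a b => by
        obtain ⟨a, rfl⟩ := mk_surjective a
        obtain ⟨b, rfl⟩ := mk_surjective b
        simp [← mk_mul, hπ₀]
      map_star' := fun a => by
        obtain ⟨a, rfl⟩ := mk_surjective a
        simp [← mk_star, hπ₀, freeLift_star] }
  refine ⟨π, ⟨fun v f => ?_, fun e g => ?_⟩, fun ψ hψ => ?_⟩
  · exact (hπ₀ _).trans (by simp [freeP, freeLift_single, symbVal])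
  · exact (hπ₀ _).trans (by simp [freeS, freeLift_single, symbVal])
  · ext a
    obtain ⟨a, rfl⟩ := mk_surjective a
    change ψ (mk R Γ a) = freeLift P S a
    induction a using MonoidAlgebra.induction_linear with
    | zero => rw [mk_zero, map_zero, map_zero]
    | add a b ha hb => rw [mk_add, map_add, map_add, ha, hb]
    | single y r =>
      have h1 : (MonoidAlgebra.single y r : FreeStarAlg R G V E) =
          r • MonoidAlgebra.single y 1 := by simp
      rw [h1, mk_smul, map_smul, map_smul]
      congr 1
      induction y using FreeSemigroup.recOnMul with
      | ih1 a =>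
        rw [freeLift_single, one_smul, FreeSemigroup.lift_of]
        have hst : ∀ a : Symb G V E, (MonoidAlgebra.single (FreeSemigroup.of a.adj) (1 : R)) =
            star (MonoidAlgebra.single (FreeSemigroup.of a) (1 : R)) := fun a => by
          change _ = freeStar _
          rw [freeStar_single, star_one, Word.adj_of]
        cases a with
        | P v f => exact hψ.1 v f
        | S e g => exact hψ.2 e g
        | Pstar v f =>
          change ψ (mk R Γ (MonoidAlgebra.single (FreeSemigroup.of (Symb.P v f).adj) 1)) = _
          rw [hst, mk_star, map_star]
          exact congrArg star (hψ.1 v f)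
        | Sstar e g =>
          change ψ (mk R Γ (MonoidAlgebra.single (FreeSemigroup.of (Symb.S e g).adj) 1)) = _
          rw [hst, mk_star, map_star]
          exact congrArg star (hψ.2 e g)
      | ih2 a y ha hy =>
        have h2 : (MonoidAlgebra.single (FreeSemigroup.of a * y) (1 : R)) =
            MonoidAlgebra.single (FreeSemigroup.of a) 1 * MonoidAlgebra.single y 1 := by
          rw [MonoidAlgebra.single_mul_single, one_mul]
        rw [h2, mk_mul, map_mul, map_mul, ha (by simp), hy (by simp)]

end Lift

end ExelPardoAlgebra

end Algebra

end ExelPardo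

namespace ExelPardo

universe u v w x

variable {G : Type u} {V : Type v} {E : Type w} [Group G] [MulAction G V] [MulAction G E]

/-! ### Combinatorics of the self-similar action on finite and infinite paths. -/

namespace SelfSimilarGraph

variable (Γ : SelfSimilarGraph G V E)

/-! ### Paths as lists of edges -/

/-! Sufficiency. Let `R` be a field and `I` a nonzero ideal. Right multiplication by s_l with `l`
long turns any element into a combination of elements s_α u_g with s(α) = g · y for one vertex y
(`exists_mul_pathElem_mem_tripleSpan`), so `I` contains a nonzero combination of this kind; take one
with the fewest terms. As long as right multiplication by s_l does not kill it, its terms stay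
distinct, since collecting equal ones would give a shorter combination. Two terms that are still
distinct after a sufficiently long `l` acquire incomparable paths once `l` is lengthened further
(`exists_incomparable_translate`). If one path properly extends the other, an entry of a circuit
separates them. If the paths agree, the quotient of the two group elements does not strongly fix
`l`; by finiteness of the minimal strongly fixed paths it then strongly fixes no extension of `l`,
and by condition 3 it moves one. The adjoint of one term now kills all the others and leaves a
scalar multiple of a vertex projection, so `I` contains some p_{v,1} (`exists_p_mem`). Weak
transitivity spreads this to all vertices (`forall_p_mem`), and finite sums of vertex projections
are local units.

Necessity. The algebra acts on the functions on any set whose points behave like infinite paths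
(`PathAction.rep`), and when it is simple every such representation on a nonempty set with nonzero
coefficients is faithful (`rep_injective`). Failure of a condition produces either a nonzero element
that acts as zero (coefficients in R/(r), or functions on the tail class of one infinite path), or
two elements that agree on functions on E^∞, hence are equal, but are told apart by a decorated
version of E^∞ that records a degree and the eventual values of the cocycle (`PathAction.germ`). -/

theorem φ_one (e : E) : Γ.φ 1 e = 1 := by
  have h := Γ.φ_mul 1 1 e
  rw [one_smul, one_mul] at h
  exact (mul_eq_left.1 h.symm)

theorem cocycleList_one (l : List E) : Γ.cocycleList 1 l = 1 := by
  induction l with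
  | nil => rfl
  | cons e l ih => rw [cocycleList, φ_one, ih]

theorem actList_one (l : List E) : Γ.actList 1 l = l := by
  induction l with
  | nil => rfl
  | cons e l ih => rw [actList, φ_one, ih, one_smul]

theorem length_actList (g : G) (l : List E) : (Γ.actList g l).length = l.length := by
  induction l generalizing g with
  | nil => rfl
  | cons e l ih => simp [actList, ih]

theorem cocycleList_mul (g h : G) (l : List E) :
    Γ.cocycleList (g * h) l = Γ.cocycleList g (Γ.actList h l) * Γ.cocycleList h l := by
  induction l generalizing g h with
  | nil => rfl
  | cons e l ih => simp [actList, cocycleList, φ_mul, ih]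

theorem actList_mul (g h : G) (l : List E) :
    Γ.actList (g * h) l = Γ.actList g (Γ.actList h l) := by
  induction l generalizing g h with
  | nil => rfl
  | cons e l ih => simp [actList, φ_mul, ih, mul_smul]

theorem actList_injective (g : G) : Function.Injective (Γ.actList g) := by
  intro l m h
  rw [← Γ.actList_one l, ← Γ.actList_one m, ← inv_mul_cancel g, actList_mul, actList_mul, h]

theorem actList_append (g : G) (l m : List E) :
    Γ.actList g (l ++ m) = Γ.actList g l ++ Γ.actList (Γ.cocycleList g l) m := by
  induction l generalizing g with
  | nil => rfl
  | cons e l ih => simp [actList, cocycleList, ih]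

theorem cocycleList_append (g : G) (l m : List E) :
    Γ.cocycleList g (l ++ m) = Γ.cocycleList (Γ.cocycleList g l) m := by
  induction l generalizing g with
  | nil => rfl
  | cons e l ih => simp [cocycleList, ih]

theorem cocycleList_smul (g : G) (l : List E) (v : V) : Γ.cocycleList g l • v = g • v := by
  induction l generalizing g with
  | nil => rfl
  | cons e l ih => rw [cocycleList, ih, φ_smul_vertex]

theorem isPathFrom_append {v : V} {l m : List E} :
    Γ.IsPathFrom v (l ++ m) ↔ Γ.IsPathFrom v l ∧ Γ.IsPathFrom (Γ.sourceFrom v l) m := by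
  induction l generalizing v with
  | nil => simp [IsPathFrom, sourceFrom]
  | cons e l ih => simp [IsPathFrom, sourceFrom, ih, and_assoc]

theorem sourceFrom_append (v : V) (l m : List E) :
    Γ.sourceFrom v (l ++ m) = Γ.sourceFrom (Γ.sourceFrom v l) m := by
  induction l generalizing v with
  | nil => rfl
  | cons e l ih => simp [sourceFrom, ih]

theorem sourceFrom_actList (g : G) (v : V) (l : List E) :
    Γ.sourceFrom (g • v) (Γ.actList g l) = g • Γ.sourceFrom v l := by
  induction l generalizing g v with
  | nil => rfl
  | cons e l ih => rw [actList, sourceFrom, s_smul, ← Γ.φ_smul_vertex g e, ih, φ_smul_vertex,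
      sourceFrom]

theorem exists_isPathFrom_length (v : V) (n : ℕ) :
    ∃ l : List E, Γ.IsPathFrom v l ∧ l.length = n := by
  induction n generalizing v with
  | zero => exact ⟨[], trivial, rfl⟩
  | succ n ih =>
    obtain ⟨e, he⟩ := Γ.no_sources v
    obtain ⟨l, hl, hn⟩ := ih (Γ.s e)
    exact ⟨e :: l, ⟨he, hl⟩, by simp [hn]⟩

variable {Γ}

theorem FinPath.ext {α β : Γ.FinPath} (h : α.range = β.range) (h' : α.edges = β.edges) : α = β := by
  cases α; cases β; cases h; cases h'; rfl

/-- The range needs no separate condition: φ(g, α) acts on vertices as g does, so φ(g, α) = 1 forces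
g to fix every vertex. -/
theorem FinPath.stronglyFixedBy_iff {α : Γ.FinPath} {g : G} : α.StronglyFixedBy g ↔
    Γ.actList g α.edges = α.edges ∧ Γ.cocycleList g α.edges = 1 := by
  constructor
  · intro h
    exact ⟨congrArg FinPath.edges h.1, h.2⟩
  · intro h
    refine ⟨FinPath.ext ?_ h.1, h.2⟩
    change g • α.range = α.range
    rw [← Γ.cocycleList_smul g α.edges, h.2, one_smul]

variable (Γ)

/-- The list form of being strongly fixed. -/
def FixesStrongly (g : G) (l : List E) : Prop := Γ.actList g l = l ∧ Γ.cocycleList g l = 1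

variable {Γ}

theorem FixesStrongly.append {g : G} {l : List E} (h : Γ.FixesStrongly g l) (m : List E) :
    Γ.FixesStrongly g (l ++ m) := by
  refine ⟨?_, ?_⟩
  · rw [actList_append, h.1, h.2, actList_one]
  · rw [cocycleList_append, h.2, cocycleList_one]

theorem FixesStrongly.of_prefix {g : G} {l m : List E} (h : Γ.FixesStrongly g l) (hm : l <+: m) :
    Γ.FixesStrongly g m := by
  obtain ⟨k, rfl⟩ := hm
  exact h.append k

/-- If only finitely many paths with range `v` are minimal strongly fixed by `g`, then a long path
that is not strongly fixed has no strongly fixed extension. -/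
theorem exists_length_fixesStrongly (hfin : Γ.FinitelyManyMinimalStronglyFixed) (g : G) (v : V) :
    ∃ N : ℕ, ∀ l m : List E, N ≤ l.length → Γ.IsPathFrom v (l ++ m) →
      Γ.FixesStrongly g (l ++ m) → Γ.FixesStrongly g l := by
  classical
  obtain ⟨N, hN⟩ := ((hfin g v).image FinPath.length).bddAbove
  refine ⟨N, fun l m hl hp hf => ?_⟩
  -- The shortest strongly fixed prefix of `l ++ m` is a minimal strongly fixed path, so its length
  -- is at most `N` and it is already a prefix of `l`.
  have hex : ∃ n, Γ.FixesStrongly g ((l ++ m).take n) := ⟨(l ++ m).length, by rwa [List.take_length]⟩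
  have hn := Nat.find_spec hex
  set n := Nat.find hex with hndef
  have hpn : Γ.IsPathFrom v ((l ++ m).take n) := by
    rw [← List.take_append_drop n (l ++ m)] at hp
    exact (Γ.isPathFrom_append.1 hp).1
  have hlen : ((l ++ m).take n).length ≤ N := by
    refine hN ⟨⟨v, _, hpn⟩, ⟨rfl, FinPath.stronglyFixedBy_iff.2 hn, ?_⟩, rfl⟩
    intro β hβ hne hβf
    rw [FinPath.stronglyFixedBy_iff] at hβf
    have hlt : β.edges.length < n := by
      by_contra hcon
      refine hne (FinPath.ext hβ.1 (hβ.2.eq_of_length_le ?_))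
      exact (List.length_take_le n _).trans (not_lt.1 hcon)
    refine Nat.find_min hex hlt ?_
    have : β.edges = (l ++ m).take β.edges.length :=
      List.prefix_iff_eq_take.1 (hβ.2.trans (List.take_prefix _ _))
    rw [← this]
    exact hβf
  exact hn.of_prefix (List.prefix_of_prefix_length_le (List.take_prefix _ _)
    (List.prefix_append l m) (hlen.trans hl))

/-! ### Infinite paths -/

namespace InfPath

theorem ext {ξ η : Γ.InfPath} (h : ∀ n, ξ.edge n = η.edge n) : ξ = η := by
  cases ξ; cases η
  obtain rfl := funext h
  rfl

/-- The infinite path `e₁ e₂ …`. -/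
def tail (ξ : Γ.InfPath) : Γ.InfPath := ⟨fun n => ξ.edge (n + 1), fun n => ξ.isPath (n + 1)⟩

/-- The infinite path `e ξ`. -/
def cons (e : E) (ξ : Γ.InfPath) (h : ξ.range = Γ.s e) : Γ.InfPath where
  edge n := n.casesOn e ξ.edge
  isPath n := by
    cases n with
    | zero => exact h.symm
    | succ n => exact ξ.isPath n

theorem range_tail (ξ : Γ.InfPath) : ξ.tail.range = Γ.s (ξ.edge 0) := (ξ.isPath 0).symm

theorem cocyclePrefix_one (ξ : Γ.InfPath) (n : ℕ) : ξ.cocyclePrefix 1 n = 1 := by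
  induction n with
  | zero => rfl
  | succ n ih => rw [cocyclePrefix, ih, φ_one]

theorem act_one (ξ : Γ.InfPath) : ξ.act 1 = ξ :=
  ext fun n => by simp [act, cocyclePrefix_one]

theorem cocyclePrefix_mul (g h : G) (ξ : Γ.InfPath) (n : ℕ) :
    ξ.cocyclePrefix (g * h) n = (ξ.act h).cocyclePrefix g n * ξ.cocyclePrefix h n := by
  induction n with
  | zero => rfl
  | succ n ih => rw [cocyclePrefix, ih, φ_mul]; rfl

theorem act_mul (g h : G) (ξ : Γ.InfPath) : ξ.act (g * h) = (ξ.act h).act g :=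
  ext fun n => by simp [act, cocyclePrefix_mul, mul_smul]

theorem cocyclePrefix_succ' (g : G) (ξ : Γ.InfPath) (n : ℕ) :
    ξ.cocyclePrefix g (n + 1) = ξ.tail.cocyclePrefix (Γ.φ g (ξ.edge 0)) n := by
  induction n with
  | zero => rfl
  | succ n ih => rw [cocyclePrefix, ih]; rfl

theorem tail_act (g : G) (ξ : Γ.InfPath) :
    (ξ.act g).tail = ξ.tail.act (Γ.φ g (ξ.edge 0)) :=
  ext fun n => by
    change ξ.cocyclePrefix g (n + 1) • _ = _
    rw [cocyclePrefix_succ']; rfl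

theorem range_act (g : G) (ξ : Γ.InfPath) : (ξ.act g).range = g • ξ.range := Γ.r_smul _ _

/-- The initial segment of length `n`. -/
def pre : ℕ → Γ.InfPath → List E
  | 0, _ => []
  | n + 1, ξ => ξ.edge 0 :: pre n ξ.tail

theorem length_pre (n : ℕ) (ξ : Γ.InfPath) : (ξ.pre n).length = n := by
  induction n generalizing ξ with
  | zero => rfl
  | succ n ih => simp [pre, ih]

theorem isPathFrom_pre (n : ℕ) (ξ : Γ.InfPath) : Γ.IsPathFrom ξ.range (ξ.pre n) := by
  induction n generalizing ξ with
  | zero => trivial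
  | succ n ih => exact ⟨rfl, ξ.range_tail ▸ ih ξ.tail⟩

theorem sourceFrom_pre (n : ℕ) (ξ : Γ.InfPath) :
    Γ.sourceFrom ξ.range (ξ.pre n) = Γ.r (ξ.edge n) := by
  induction n generalizing ξ with
  | zero => rfl
  | succ n ih =>
    have := ih ξ.tail
    rw [range_tail] at this
    exact this

theorem actList_pre (g : G) (n : ℕ) (ξ : Γ.InfPath) :
    Γ.actList g (ξ.pre n) = (ξ.act g).pre n := by
  induction n generalizing ξ g with
  | zero => rfl
  | succ n ih => rw [pre, pre, actList, ih, tail_act]; rfl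

theorem cocycleList_pre (g : G) (n : ℕ) (ξ : Γ.InfPath) :
    Γ.cocycleList g (ξ.pre n) = ξ.cocyclePrefix g n := by
  induction n generalizing ξ g with
  | zero => rfl
  | succ n ih => rw [pre, cocycleList, ih, cocyclePrefix_succ']

theorem pre_succ' (n : ℕ) (ξ : Γ.InfPath) : ξ.pre (n + 1) = ξ.pre n ++ [ξ.edge n] := by
  induction n generalizing ξ with
  | zero => rfl
  | succ n ih => rw [pre, ih, pre, List.cons_append]; rfl

theorem eq_of_pre {ξ η : Γ.InfPath} (h : ∀ n, ξ.pre n = η.pre n) : ξ = η :=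
  ext fun n => by
    have := h (n + 1)
    rw [pre_succ', pre_succ', h n] at this
    simpa using this

/-- A property of finite paths that can always be extended by one edge holds along some infinite
path. -/
theorem exists_forall_pre (Q : List E → Prop) (v : V) (h0 : Q [])
    (hs : ∀ l, Γ.IsPathFrom v l → Q l → ∃ e, Γ.r e = Γ.sourceFrom v l ∧ Q (l ++ [e])) :
    ∃ ξ : Γ.InfPath, ξ.range = v ∧ ∀ n, Q (ξ.pre n) := by
  have : Nonempty E := (Γ.no_sources v).nonempty
  choose! f hf1 hf2 using hs
  let L : ℕ → List E := fun n => n.rec [] fun _ l => l ++ [f l]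
  have hL : ∀ n, L (n + 1) = L n ++ [f (L n)] := fun n => rfl
  have hLn : ∀ n, Γ.IsPathFrom v (L n) ∧ Q (L n) := by
    intro n
    induction n with
    | zero => exact ⟨trivial, h0⟩
    | succ n ih =>
      refine ⟨?_, hf2 _ ih.1 ih.2⟩
      rw [hL, isPathFrom_append]
      exact ⟨ih.1, hf1 _ ih.1 ih.2, trivial⟩
  let ξ : Γ.InfPath := ⟨fun n => f (L n), fun n => by
    rw [hf1 _ (hLn (n + 1)).1 (hLn (n + 1)).2, hL, sourceFrom_append]; rfl⟩
  have hpre : ∀ n, ξ.pre n = L n := by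
    intro n
    induction n with
    | zero => rfl
    | succ n ih => rw [pre_succ', ih]
  exact ⟨ξ, hf1 _ (hLn 0).1 (hLn 0).2, fun n => hpre n ▸ (hLn n).2⟩

theorem exists_range_eq (Γ : SelfSimilarGraph G V E) (v : V) : ∃ ξ : Γ.InfPath, ξ.range = v := by
  obtain ⟨ξ, h, -⟩ := exists_forall_pre (Γ := Γ) (fun _ => True) v trivial fun l _ _ => by
    simpa using Γ.no_sources _
  exact ⟨ξ, h⟩

end InfPath

/-! ### Separating translates of paths -/

/-- Neither of the two lists is a prefix of the other one. -/
def Incomparable (l m : List E) : Prop := ¬ l <+: m ∧ ¬ m <+: l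

theorem Incomparable.symm {l m : List E} (h : Incomparable l m) : Incomparable m l := ⟨h.2, h.1⟩

theorem Incomparable.append {l m : List E} (h : Incomparable l m) (l' m' : List E) :
    Incomparable (l ++ l') (m ++ m') := by
  constructor
  · intro h'
    exact (List.prefix_or_prefix_of_prefix ((List.prefix_append l l').trans h')
      (List.prefix_append m m')).elim h.1 h.2
  · intro h'
    exact (List.prefix_or_prefix_of_prefix ((List.prefix_append m m').trans h')
      (List.prefix_append l l')).elim h.2 h.1

/-- If `g` strongly fixes no extension of `l`, then it moves some extension of `l`. -/
theorem exists_actList_ne (hslack : ∀ (v : V) (g : G), Γ.FixesCylinder g v → Γ.SlackAt g v)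
    {w : V} {g : G} {l : List E} (hl : Γ.IsPathFrom w l)
    (hf : ∀ m, Γ.IsPathFrom w (l ++ m) → ¬ Γ.FixesStrongly g (l ++ m)) :
    ∃ m, Γ.IsPathFrom w (l ++ m) ∧ Γ.actList g (l ++ m) ≠ l ++ m := by
  by_cases hgl : Γ.actList g l = l
  swap
  · exact ⟨[], by simpa using hl, by simpa using hgl⟩
  -- If φ(g, l) were slack at s(l), then `l` followed by a long enough path would be strongly fixed
  -- by `g`.
  have h1 : ¬ Γ.SlackAt (Γ.cocycleList g l) (Γ.sourceFrom w l) := by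
    rintro ⟨n, hn⟩
    obtain ⟨m, hm, hmn⟩ := Γ.exists_isPathFrom_length (Γ.sourceFrom w l) n
    have := FinPath.stronglyFixedBy_iff.1 (hn ⟨_, m, hm⟩ rfl hmn.ge)
    refine hf m (Γ.isPathFrom_append.2 ⟨hl, hm⟩) ⟨?_, ?_⟩
    · rw [actList_append, hgl, this.1]
    · rw [cocycleList_append, this.2]
  have h2 : ¬ Γ.FixesCylinder _ _ := fun h => h1 (hslack _ _ h)
  simp only [FixesCylinder, not_forall, exists_prop] at h2
  obtain ⟨ξ, hξ, hne⟩ := h2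
  have h3 : ∃ n, (ξ.act (Γ.cocycleList g l)).pre n ≠ ξ.pre n := by
    by_contra! h
    exact hne (InfPath.eq_of_pre h)
  obtain ⟨n, hn⟩ := h3
  have hξ' : ξ.range = _ := hξ
  refine ⟨ξ.pre n, Γ.isPathFrom_append.2 ⟨hl, hξ' ▸ ξ.isPathFrom_pre n⟩, ?_⟩
  rw [actList_append, hgl, InfPath.actList_pre]
  simpa using hn

/-- If every circuit has an entry, then `γ ≠ ∅` and `g` with `s(γ) = g · w` yield arbitrarily
long paths `μ` with range `w` that are not prefixes of `γ (g · μ)`. -/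
theorem exists_not_prefix (hentry : Γ.EveryCircuitHasEntry) {w : V} {g : G} {γ l : List E}
    (hγ : Γ.IsPathFrom w γ) (hne : γ ≠ []) (hs : Γ.sourceFrom w γ = g • w)
    (hl : Γ.IsPathFrom w l) :
    ∃ m, Γ.IsPathFrom w (l ++ m) ∧ ¬ l ++ m <+: γ ++ Γ.actList g (l ++ m) := by
  by_contra! hcon
  have hl' := hcon [] (by simpa using hl)
  rw [List.append_nil] at hl'
  obtain ⟨ν, hν⟩ := hl'
  have hp : Γ.IsPathFrom w (γ ++ Γ.actList g l) :=
    Γ.isPathFrom_append.2 ⟨hγ, hs ▸ Γ.isPathFrom_actList g w l hl⟩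
  have hsrc : Γ.sourceFrom w (γ ++ Γ.actList g l) = g • Γ.sourceFrom w l := by
    rw [sourceFrom_append, hs, sourceFrom_actList]
  rw [← hν, isPathFrom_append] at hp
  rw [← hν, sourceFrom_append] at hsrc
  have hlen := congrArg List.length hν
  simp only [List.length_append, length_actList] at hlen
  have hγ0 := List.length_pos_iff.2 hne
  -- Since l ν = γ (g · l), the path ν starts at s(l), ends at g · s(l) and has the positive length
  -- of γ: it is a circuit.
  obtain ⟨e, he, f, hfe, hr⟩ := hentry g ⟨_, ν, hp.2⟩ ⟨by change 0 < ν.length; omega, hsrc⟩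
  obtain ⟨ν₁, ν₂, rfl⟩ := List.append_of_mem he
  have hp2 := (Γ.isPathFrom_append.1 hp.2)
  have hpe : Γ.r e = _ := hp2.2.1
  -- Because γ is nonempty, the prefix l ν₁ d of γ (g · (l ν₁ d)) already lies inside γ (g · (l
  -- ν₁)), which does not involve d. So d is determined, contradicting the choice between `e` and
  -- `f`.
  have key : ∀ d, Γ.r d = Γ.r e → l ++ (ν₁ ++ [d]) <+: γ ++ Γ.actList g (l ++ ν₁) := by
    intro d hd
    have h1 := hcon (ν₁ ++ [d]) (Γ.isPathFrom_append.2 ⟨hl, Γ.isPathFrom_append.2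
      ⟨hp2.1, hd.trans hpe, trivial⟩⟩)
    refine List.prefix_of_prefix_length_le h1 ?_ ?_
    · rw [← List.append_assoc l, Γ.actList_append g (l ++ ν₁), ← List.append_assoc]
      exact List.prefix_append _ _
    · simp [length_actList]
      omega
  have := List.prefix_of_prefix_length_le (key e rfl) (key f hr) (by simp)
  have := this.eq_of_length (by simp)
  simp at this
  exact hfe this.symm

end SelfSimilarGraph

namespace SelfSimilarGraph

variable {Γ : SelfSimilarGraph G V E}

theorem actList_prefix (Γ : SelfSimilarGraph G V E) (g : G) {l m : List E} (h : l <+: m) :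
    Γ.actList g l <+: Γ.actList g m := by
  obtain ⟨k, rfl⟩ := h
  rw [actList_append]
  exact List.prefix_append _ _

/-- Cancelling α and applying h⁻¹ turns "α (h · μ) is a prefix of α γ (k · μ)" into "μ is a prefix
of γ' (g · μ)" with γ' = h⁻¹ · γ and g = φ(h⁻¹, γ) k, which is the situation of `exists_not_prefix`.
The opposite prefix relation fails by length. -/
theorem exists_incomparable_append (hentry : Γ.EveryCircuitHasEntry) {v x : V} {h k : G}
    {α γ l : List E} (hp : Γ.IsPathFrom v (α ++ γ)) (hα : Γ.sourceFrom v α = h • x)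
    (hγ : Γ.sourceFrom v (α ++ γ) = k • x) (hne : γ ≠ []) (hl : Γ.IsPathFrom x l) :
    ∃ m, Γ.IsPathFrom x (l ++ m) ∧
      Incomparable (α ++ Γ.actList h (l ++ m)) (α ++ γ ++ Γ.actList k (l ++ m)) := by
  rw [isPathFrom_append, hα] at hp
  rw [sourceFrom_append, hα] at hγ
  have hp' := Γ.isPathFrom_actList h⁻¹ _ _ hp.2
  have hs' := Γ.sourceFrom_actList h⁻¹ (h • x) γ
  rw [inv_smul_smul] at hp' hs'
  have hlen := List.length_pos_iff.2 hne
  obtain ⟨m, hm, hmn⟩ := Γ.exists_not_prefix hentry (g := Γ.cocycleList h⁻¹ γ * k) hp'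
    (by rw [← List.length_pos_iff, length_actList]; exact hlen)
    (by rw [hs', hγ, mul_smul, cocycleList_smul]) hl
  refine ⟨m, hm, ?_, ?_⟩
  · rw [List.append_assoc, List.prefix_append_right_inj]
    intro hpre
    refine hmn ?_
    have := Γ.actList_prefix h⁻¹ hpre
    rwa [← actList_mul, inv_mul_cancel, actList_one, Γ.actList_append h⁻¹ γ, ← actList_mul] at this
  · intro hpre
    have := hpre.length_le
    simp only [List.length_append, length_actList] at this
    omega

end SelfSimilarGraph

theorem star_single_of {R : Type*} [CommRing R] [StarRing R] {A B C : Type*} (a : Symb A B C) :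
    star (MonoidAlgebra.single (FreeSemigroup.of a) 1 : FreeStarAlg R A B C) =
      MonoidAlgebra.single (FreeSemigroup.of a.adj) 1 := by
  change freeStar _ = _
  rw [freeStar_single, star_one, Word.adj_of]

/-! ### Sufficiency: local units, products of generators and expansion along long paths. -/

namespace ExelPardoAlgebra

open SelfSimilarGraph

variable {R : Type x} [CommRing R] [StarRing R] {Γ : SelfSimilarGraph G V E}

/-! ### Relations between the generators -/

theorem star_p (v : V) (f : G) : star (p R Γ v f) = p R Γ (f⁻¹ • v) f⁻¹ :=
  isGEFamily R Γ _ _ (.star_vertex v f)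

open Classical in
theorem p_mul_p (v w : V) (f h : G) :
    p R Γ v f * p R Γ w h = if v = f • w then p R Γ v (f * h) else 0 :=
  isGEFamily R Γ _ _ (.vertex_vertex v w f h)

open Classical in
theorem p_mul_s (v : V) (e : E) (f g : G) : p R Γ v f * s R Γ e g =
    if v = Γ.r (f • e) then s R Γ (f • e) (Γ.φ f e * g) else 0 :=
  isGEFamily R Γ _ _ (.vertex_edge v e f g)

open Classical in
theorem s_mul_p (e : E) (v : V) (g f : G) : s R Γ e g * p R Γ v f =
    if g • v = Γ.s e then s R Γ e (g * f) else 0 :=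
  isGEFamily R Γ _ _ (.edge_vertex e v g f)

open Classical in
theorem star_s_mul_s (e f : E) : star (s R Γ e 1) * s R Γ f 1 =
    if e = f then p R Γ (Γ.s e) 1 else 0 :=
  isGEFamily R Γ _ _ (.star_mul_edge e f)

theorem p_eq_sum (v : V) : p R Γ v 1 =
    ∑ e ∈ (Γ.finite_range_fiber v).toFinset, s R Γ e 1 * star (s R Γ e 1) :=
  isGEFamily R Γ _ _ (.vertex_sum v)

theorem s_eq_mul (e : E) (g : G) : s R Γ e g = s R Γ e 1 * p R Γ (Γ.s e) g := by
  rw [s_mul_p, if_pos (one_smul _ _), one_mul]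

theorem p_one_mul_self (v : V) (f : G) : p R Γ v 1 * p R Γ v f = p R Γ v f := by
  rw [p_mul_p, if_pos (one_smul _ _).symm, one_mul]

theorem p_one_mul_s (e : E) (g : G) : p R Γ (Γ.r e) 1 * s R Γ e g = s R Γ e g := by
  rw [p_mul_s, if_pos (by rw [one_smul]), one_smul, Γ.φ_one, one_mul]

theorem p_one_mul_p_one_of_ne {v w : V} (h : v ≠ w) : p R Γ v 1 * p R Γ w 1 = 0 := by
  rw [p_mul_p, if_neg (by rwa [one_smul])]

/-- Induction over the expressions in the generators. -/
theorem induction_on {Q : ExelPardoAlgebra R Γ → Prop} (a : ExelPardoAlgebra R Γ)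
    (zero : Q 0) (add : ∀ a b, Q a → Q b → Q (a + b)) (smul : ∀ (r : R) a, Q a → Q (r • a))
    (mul : ∀ a b, Q a → Q b → Q (a * b)) (hp : ∀ v f, Q (p R Γ v f)) (hs : ∀ e g, Q (s R Γ e g))
    (hs' : ∀ e g, Q (star (s R Γ e g))) : Q a := by
  obtain ⟨a, rfl⟩ := mk_surjective a
  induction a using MonoidAlgebra.induction_linear with
  | zero => exact zero
  | add a b ha hb => exact add _ _ ha hb
  | single y r =>
    have h1 : (MonoidAlgebra.single y r : FreeStarAlg R G V E) =
        r • MonoidAlgebra.single y 1 := by simp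
    rw [h1, mk_smul]
    refine smul _ _ ?_
    have hof : ∀ a : Symb G V E, Q (mk R Γ (MonoidAlgebra.single (FreeSemigroup.of a) 1)) := by
      intro a
      cases a with
      | P v f => exact hp v f
      | S e g => exact hs e g
      | Pstar v f =>
        have := hp (f⁻¹ • v) f⁻¹
        rw [← star_p] at this
        change Q (mk R Γ (MonoidAlgebra.single (FreeSemigroup.of (Symb.P v f).adj) 1))
        rwa [← star_single_of, mk_star]
      | Sstar e g =>
        change Q (mk R Γ (MonoidAlgebra.single (FreeSemigroup.of (Symb.S e g).adj) 1))
        rw [← star_single_of, mk_star]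
        exact hs' e g
    induction y using FreeSemigroup.recOnMul with
    | ih1 a => exact hof a
    | ih2 a y _ hy =>
      have h2 : (MonoidAlgebra.single (FreeSemigroup.of a * y) (1 : R)) =
          MonoidAlgebra.single (FreeSemigroup.of a) 1 * MonoidAlgebra.single y 1 := by
        rw [MonoidAlgebra.single_mul_single, one_mul]
      rw [h2, mk_mul]
      exact mul _ _ (hof a) (hy (by simp))

/-- Local units. Allowing every larger `F'` lets one finite set serve two summands at once. -/
theorem exists_sum_p_mul (a : ExelPardoAlgebra R Γ) : ∃ F : Finset V, ∀ F', F ⊆ F' →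
    (∑ v ∈ F', p R Γ v 1) * a = a := by
  classical
  have hsingle : ∀ (v : V) (a : ExelPardoAlgebra R Γ), p R Γ v 1 * a = a →
      ∃ F : Finset V, ∀ F', F ⊆ F' → (∑ v ∈ F', p R Γ v 1) * a = a := by
    intro v a ha
    refine ⟨{v}, fun F' hF => ?_⟩
    rw [← ha, ← mul_assoc, Finset.sum_mul, Finset.sum_eq_single_of_mem v (by simpa using hF),
      p_one_mul_self]
    exact fun w _ hw => p_one_mul_p_one_of_ne hw
  induction a using induction_on with
  | zero => exact ⟨∅, by simp⟩
  | add a b ha hb =>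
    obtain ⟨F, hF⟩ := ha
    obtain ⟨F', hF'⟩ := hb
    refine ⟨F ∪ F', fun F'' h => ?_⟩
    rw [mul_add, hF _ (Finset.union_subset_left h), hF' _ (Finset.union_subset_right h)]
  | smul r a ha =>
    obtain ⟨F, hF⟩ := ha
    exact ⟨F, fun F' h => by rw [mul_smul_comm, hF _ h]⟩
  | mul a b ha hb =>
    obtain ⟨F, hF⟩ := ha
    exact ⟨F, fun F' h => by rw [← mul_assoc, hF _ h]⟩
  | hp v f => exact hsingle v _ (p_one_mul_self v f)
  | hs e g => exact hsingle _ _ (p_one_mul_s e g)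
  | hs' e g =>
    -- s_{e,g}^* = p_{s(e),g}^* s_{e,1}^*, and p_{s(e),g}^* is supported at g⁻¹ · s(e).
    refine hsingle (g⁻¹ • Γ.s e) _ ?_
    rw [s_eq_mul, star_mul, star_p, ← mul_assoc, p_one_mul_self]

theorem exists_mul_p_ne_zero {a : ExelPardoAlgebra R Γ} (ha : a ≠ 0) :
    ∃ v, a * p R Γ v 1 ≠ 0 := by
  by_contra! h
  obtain ⟨F, hF⟩ := exists_sum_p_mul (star a)
  have h1 := congrArg star (hF F subset_rfl)
  rw [star_mul, star_star, star_sum, Finset.mul_sum, Finset.sum_eq_zero] at h1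
  · exact ha h1.symm
  · intro v _
    rw [star_p, inv_one, one_smul, h]

/-! ### The elements `s_α u_g` -/

variable (R Γ) in
/-- The element `s_α u_g` for the path `α` with range `v` and edges `l`. -/
noncomputable def pathElem : V → List E → G → ExelPardoAlgebra R Γ
  | v, [], g => p R Γ v g
  | _, e :: l, g => s R Γ e 1 * pathElem (Γ.s e) l g

open Classical in
theorem pathElem_mul_p (v w : V) (l : List E) (g f : G) : pathElem R Γ v l g * p R Γ w f =
    if Γ.sourceFrom v l = g • w then pathElem R Γ v l (g * f) else 0 := by
  induction l generalizing v with
  | nil => exact p_mul_p _ _ _ _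
  | cons e l ih =>
    rw [pathElem, mul_assoc, ih, mul_ite, mul_zero]
    rfl

open Classical in
theorem p_mul_pathElem (v w : V) (l : List E) (f g : G) (hl : Γ.IsPathFrom w l) :
    p R Γ v f * pathElem R Γ w l g = if v = f • w then
      pathElem R Γ v (Γ.actList f l) (Γ.cocycleList f l * g) else 0 := by
  induction l generalizing v w f with
  | nil => exact p_mul_p _ _ _ _
  | cons e l ih =>
    rw [pathElem, ← mul_assoc, p_mul_s, Γ.r_smul, hl.1]
    split_ifs with h
    · rw [s_eq_mul, mul_assoc, ih _ _ _ hl.2, if_pos, mul_one]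
      · rfl
      · rw [mul_one, s_smul, φ_smul_vertex]
    · rw [zero_mul]

theorem p_one_mul_pathElem {w : V} {l : List E} (g : G) (hl : Γ.IsPathFrom w l) :
    p R Γ w 1 * pathElem R Γ w l g = pathElem R Γ w l g := by
  rw [p_mul_pathElem _ _ _ _ _ hl, if_pos (one_smul _ _).symm, actList_one, cocycleList_one,
    one_mul]

theorem pathElem_mul_pathElem {v w : V} {l m : List E} {g : G} (h : G)
    (hs : Γ.sourceFrom v l = g • w) (hm : Γ.IsPathFrom w m) :
    pathElem R Γ v l g * pathElem R Γ w m h =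
      pathElem R Γ v (l ++ Γ.actList g m) (Γ.cocycleList g m * h) := by
  induction l generalizing v with
  | nil => rw [pathElem, p_mul_pathElem _ _ _ _ _ hm, if_pos (show v = g • w from hs)]; rfl
  | cons e l ih => rw [pathElem, mul_assoc, ih hs]; rfl

/-- Common first edges cancel until two different edges meet, where s_e^* s_f = 0; incomparability
ensures that this happens before either list is exhausted. -/
theorem star_pathElem_mul_of_incomparable {v w : V} {l m : List E} (g h : G)
    (hm : Γ.IsPathFrom w m) (hlm : Incomparable l m) :
    star (pathElem R Γ v l g) * pathElem R Γ w m h = 0 := by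
  induction l generalizing v w m with
  | nil => exact absurd List.nil_prefix hlm.1
  | cons e l ih =>
    cases m with
    | nil => exact absurd List.nil_prefix hlm.2
    | cons f m =>
      rw [pathElem, pathElem, star_mul, mul_assoc, ← mul_assoc (star (s R Γ e 1)), star_s_mul_s]
      split_ifs with hef
      · subst hef
        rw [p_one_mul_pathElem _ hm.2]
        refine ih hm.2 ⟨fun h' => hlm.1 ?_, fun h' => hlm.2 ?_⟩
        · exact (List.prefix_cons_inj e).2 h'
        · exact (List.prefix_cons_inj e).2 h'
      · rw [zero_mul, mul_zero]

theorem star_pathElem_mul_self {v : V} {l : List E} (g : G) (hl : Γ.IsPathFrom v l) :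
    star (pathElem R Γ v l g) * pathElem R Γ v l g = p R Γ (g⁻¹ • Γ.sourceFrom v l) 1 := by
  induction l generalizing v with
  | nil => rw [pathElem, star_p, p_mul_p, if_pos rfl, inv_mul_cancel]; rfl
  | cons e l ih =>
    rw [pathElem, star_mul, mul_assoc, ← mul_assoc (star (s R Γ e 1)), star_s_mul_s, if_pos rfl,
      p_one_mul_pathElem _ hl.2, ih hl.2]
    rfl

theorem pathElem_singleton (e : E) : pathElem R Γ (Γ.r e) [e] 1 = s R Γ e 1 := (s_eq_mul e 1).symm

/-- If all these products vanished, so would a s_l = ∑ a s_l s_e s_e^*, the sum being over the edges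
e with range s(l). -/
theorem exists_mul_pathElem_append_ne_zero {a : ExelPardoAlgebra R Γ} {v : V} {l : List E}
    (ha : a * pathElem R Γ v l 1 ≠ 0) :
    ∃ e, Γ.r e = Γ.sourceFrom v l ∧ a * pathElem R Γ v (l ++ [e]) 1 ≠ 0 := by
  by_contra! h
  refine ha ?_
  have h1 := pathElem_mul_p (R := R) (Γ := Γ) v (Γ.sourceFrom v l) l 1 1
  rw [if_pos (one_smul _ _).symm, one_mul] at h1
  rw [← h1, p_eq_sum, Finset.mul_sum, Finset.mul_sum, Finset.sum_eq_zero]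
  intro e he
  have he' : Γ.r e = Γ.sourceFrom v l := by simpa using he
  have h2 := pathElem_mul_pathElem (R := R) (Γ := Γ) (v := v) (w := Γ.r e) (l := l) (m := [e])
    (g := 1) 1 (by rw [one_smul, he']) ⟨rfl, trivial⟩
  rw [pathElem_singleton, actList_one, cocycleList_one, one_mul] at h2
  rw [← mul_assoc (pathElem R Γ v l 1), h2, ← mul_assoc, h e he', zero_mul]

theorem exists_length_mul_pathElem_ne_zero {a : ExelPardoAlgebra R Γ} {v : V}
    (ha : a * p R Γ v 1 ≠ 0) (n : ℕ) :
    ∃ l, Γ.IsPathFrom v l ∧ l.length = n ∧ a * pathElem R Γ v l 1 ≠ 0 := by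
  induction n with
  | zero => exact ⟨[], trivial, rfl, ha⟩
  | succ n ih =>
    obtain ⟨l, hl, hn, h⟩ := ih
    obtain ⟨e, he, h'⟩ := exists_mul_pathElem_append_ne_zero h
    exact ⟨l ++ [e], Γ.isPathFrom_append.2 ⟨hl, he, trivial⟩, by simp [hn], h'⟩

/-! ### Expansion along long paths -/

variable (R Γ) in
/-- The element `s_α u_g` for the triple `(r(α), α, g)`. -/
noncomputable def tripleElem (t : V × List E × G) : ExelPardoAlgebra R Γ :=
  pathElem R Γ t.1 t.2.1 t.2.2

variable (Γ) in
/-- The triple `(r(α), α, g)` consists of a path `α` of length at least `n` and of an element `g`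
with `s(α) = g · y`. -/
def IsTriple (y : V) (n : ℕ) (t : V × List E × G) : Prop :=
  Γ.IsPathFrom t.1 t.2.1 ∧ Γ.sourceFrom t.1 t.2.1 = t.2.2 • y ∧ n ≤ t.2.1.length

theorem IsTriple.mono {y : V} {n n' : ℕ} {t : V × List E × G} (h : IsTriple Γ y n t)
    (hn : n' ≤ n) : IsTriple Γ y n' t := ⟨h.1, h.2.1, hn.trans h.2.2⟩

variable (R Γ) in
/-- The span of the `s_α u_g` with `|α| ≥ n` and `s(α) = g · y`. -/
noncomputable def tripleSpan (y : V) (n : ℕ) : Submodule R (ExelPardoAlgebra R Γ) :=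
  Submodule.span R (tripleElem R Γ '' {t | IsTriple Γ y n t})

theorem tripleSpan_mono (y : V) {n n' : ℕ} (h : n' ≤ n) :
    tripleSpan R Γ y n ≤ tripleSpan R Γ y n' :=
  Submodule.span_mono (Set.image_mono fun _ ht => ht.mono h)

theorem pathElem_mem_tripleSpan {v y : V} {l : List E} {g : G} {n : ℕ} (hl : Γ.IsPathFrom v l)
    (hs : Γ.sourceFrom v l = g • y) (hn : n ≤ l.length) :
    pathElem R Γ v l g ∈ tripleSpan R Γ y n :=
  Submodule.subset_span ⟨(v, l, g), ⟨hl, hs, hn⟩, rfl⟩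

theorem p_mul_pathElem_mem (v w : V) (f : G) {l : List E} (hl : Γ.IsPathFrom w l) :
    p R Γ v f * pathElem R Γ w l 1 ∈ tripleSpan R Γ (Γ.sourceFrom w l) l.length := by
  classical
  rw [p_mul_pathElem _ _ _ _ _ hl]
  split_ifs with h
  · subst h
    refine pathElem_mem_tripleSpan (Γ.isPathFrom_actList f w l hl) ?_ (Γ.length_actList f l).ge
    rw [sourceFrom_actList, mul_one, cocycleList_smul]
  · exact zero_mem _

theorem mul_p_mem_tripleSpan {y z : V} {g : G} {n : ℕ} {a : ExelPardoAlgebra R Γ} (hz : z = g • y)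
    (ha : a ∈ tripleSpan R Γ z n) : a * p R Γ z g ∈ tripleSpan R Γ y n := by
  induction ha using Submodule.span_induction with
  | mem a ha =>
    obtain ⟨⟨w, l, h⟩, ⟨hl, hs, hn⟩, rfl⟩ := ha
    change pathElem R Γ w l h * _ ∈ _
    change _ = h • z at hs
    rw [pathElem_mul_p, if_pos hs]
    exact pathElem_mem_tripleSpan hl (by rw [hs, hz, mul_smul]) hn
  | zero => rw [zero_mul]; exact zero_mem _
  | add a b _ _ ha hb => rw [add_mul]; exact add_mem ha hb
  | smul r a _ ha => rw [smul_mul_assoc]; exact Submodule.smul_mem _ _ ha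

/-- Multiplying s_l on the left by p_{v,f} or s_{e,g} never shortens the path, and s_{e,g}^* removes
one edge. So `N` bounds the number of adjoint letters used, and a path of length at least `N` is
never exhausted. -/
theorem exists_mul_pathElem_mem_tripleSpan (a : ExelPardoAlgebra R Γ) :
    ∃ N : ℕ, ∀ v l, Γ.IsPathFrom v l → N ≤ l.length →
      a * pathElem R Γ v l 1 ∈ tripleSpan R Γ (Γ.sourceFrom v l) (l.length - N) := by
  induction a using induction_on with
  | zero => exact ⟨0, fun v l _ _ => by rw [zero_mul]; exact zero_mem _⟩
  | add a b ha hb =>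
    obtain ⟨N, hN⟩ := ha
    obtain ⟨N', hN'⟩ := hb
    refine ⟨N + N', fun v l hl hn => ?_⟩
    rw [add_mul]
    exact add_mem (tripleSpan_mono _ (by omega) (hN v l hl (by omega)))
      (tripleSpan_mono _ (by omega) (hN' v l hl (by omega)))
  | smul r a ha =>
    obtain ⟨N, hN⟩ := ha
    refine ⟨N, fun v l hl hn => ?_⟩
    rw [smul_mul_assoc]
    exact Submodule.smul_mem _ _ (hN v l hl hn)
  | mul a b ha hb =>
    obtain ⟨N, hN⟩ := ha
    obtain ⟨N', hN'⟩ := hb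
    refine ⟨N + N', fun v l hl hn => ?_⟩
    rw [mul_assoc]
    have h1 := hN' v l hl (by omega)
    generalize b * pathElem R Γ v l 1 = c at h1
    induction h1 using Submodule.span_induction with
    | mem c hc =>
      obtain ⟨⟨w, m, g⟩, ⟨hm, hs, hmn⟩, rfl⟩ := hc
      change Γ.IsPathFrom w m at hm
      change Γ.sourceFrom w m = g • _ at hs
      change _ ≤ m.length at hmn
      change a * pathElem R Γ w m g ∈ _
      -- Splitting s_m u_g as s_m times p_{s(m),g} makes the bound for `a`, which concerns trivial
      -- group elements only, applicable to s_m.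
      have h2 := pathElem_mul_p (R := R) (Γ := Γ) w (Γ.sourceFrom w m) m 1 g
      rw [if_pos (one_smul _ _).symm, one_mul] at h2
      rw [← h2, ← mul_assoc]
      exact mul_p_mem_tripleSpan hs (tripleSpan_mono _ (by omega) (hN w m hm (by omega)))
    | zero => rw [mul_zero]; exact zero_mem _
    | add a b _ _ ha hb => rw [mul_add]; exact add_mem ha hb
    | smul r a _ ha => rw [mul_smul_comm]; exact Submodule.smul_mem _ _ ha
  | hp v f => exact ⟨0, fun w l hl _ => p_mul_pathElem_mem v w f hl⟩
  | hs e g =>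
    refine ⟨0, fun w l hl _ => ?_⟩
    rw [s_eq_mul, mul_assoc, p_mul_pathElem _ _ _ _ _ hl]
    split_ifs with h
    · refine pathElem_mem_tripleSpan (v := Γ.r e) (l := e :: Γ.actList g l) ⟨rfl, ?_⟩ ?_ ?_
      · rw [h]
        exact Γ.isPathFrom_actList g w l hl
      · rw [sourceFrom, h, sourceFrom_actList, mul_one, cocycleList_smul]
      · simp [length_actList]
    · rw [mul_zero]; exact zero_mem _
  | hs' e g =>
    refine ⟨1, fun w l hl hn => ?_⟩
    cases l with
    | nil => simp at hn
    | cons f l =>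
      rw [s_eq_mul, star_mul, star_p, pathElem, mul_assoc, ← mul_assoc (star (s R Γ e 1)),
        star_s_mul_s]
      split_ifs with hef
      · subst hef
        rw [p_one_mul_pathElem _ hl.2]
        exact tripleSpan_mono _ (by simp) (p_mul_pathElem_mem _ _ _ hl.2)
      · rw [zero_mul, mul_zero]; exact zero_mem _

end ExelPardoAlgebra

/-! ### Sufficiency: separating the terms of a shortest element and generating the whole algebra. -/

namespace ExelPardoAlgebra

open SelfSimilarGraph

variable {R : Type x} [CommRing R] [StarRing R] {Γ : SelfSimilarGraph G V E}

/-! ### Translating triples -/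

variable (Γ) in
/-- The triple of `s_α u_g s_l = s_{α (g · l)} u_{φ(g, l)}`. -/
def translate (l : List E) (t : V × List E × G) : V × List E × G :=
  (t.1, t.2.1 ++ Γ.actList t.2.2 l, Γ.cocycleList t.2.2 l)

theorem tripleElem_mul_pathElem {y : V} {n : ℕ} {t : V × List E × G} (ht : IsTriple Γ y n t)
    {l : List E} (hl : Γ.IsPathFrom y l) :
    tripleElem R Γ t * pathElem R Γ y l 1 = tripleElem R Γ (translate Γ l t) := by
  rw [tripleElem, pathElem_mul_pathElem _ ht.2.1 hl, mul_one]
  rfl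

theorem IsTriple.translate {y : V} {n : ℕ} {t : V × List E × G} (ht : IsTriple Γ y n t)
    {l : List E} (hl : Γ.IsPathFrom y l) :
    IsTriple Γ (Γ.sourceFrom y l) n (translate Γ l t) := by
  refine ⟨Γ.isPathFrom_append.2 ⟨ht.1, ?_⟩, ?_, ?_⟩
  · exact ht.2.1 ▸ Γ.isPathFrom_actList _ _ _ hl
  · change Γ.sourceFrom t.1 (_ ++ _) = Γ.cocycleList _ _ • _
    rw [sourceFrom_append, ht.2.1, sourceFrom_actList, cocycleList_smul]
  · change n ≤ (t.2.1 ++ _).length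
    rw [List.length_append]
    exact ht.2.2.trans (Nat.le_add_right _ _)

/-- This is why paths of length at least 1 are required: the empty list is a prefix of every list,
whatever the ranges, whereas a nonempty list determines its range. -/
theorem IsTriple.range_eq {y : V} {t t' : V × List E × G} (ht : IsTriple Γ y 1 t)
    (ht' : IsTriple Γ y 1 t') (h : t.2.1 <+: t'.2.1) : t.1 = t'.1 := by
  obtain ⟨v, l, g⟩ := t
  obtain ⟨v', l', g'⟩ := t'
  obtain ⟨m, hm⟩ := h
  cases l with
  | nil => exact absurd ht.2.2 (by simp)
  | cons e l =>
    change e :: l ++ m = l' at hm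
    subst hm
    exact ht.1.1.symm.trans ht'.1.1

theorem incomparable_translate_append {t t' : V × List E × G} {l : List E}
    (h : Incomparable (translate Γ l t).2.1 (translate Γ l t').2.1) (m : List E) :
    Incomparable (translate Γ (l ++ m) t).2.1 (translate Γ (l ++ m) t').2.1 := by
  have := h.append (Γ.actList (Γ.cocycleList t.2.2 l) m) (Γ.actList (Γ.cocycleList t'.2.2 l) m)
  simpa only [translate, actList_append, List.append_assoc] using this

/-- Any two distinct translated triples are separated by a further translation. -/
theorem exists_incomparable_translate (hentry : Γ.EveryCircuitHasEntry)
    (hslack : ∀ (v : V) (g : G), Γ.FixesCylinder g v → Γ.SlackAt g v) {y : V}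
    {t t' : V × List E × G} (ht : IsTriple Γ y 1 t) (ht' : IsTriple Γ y 1 t') {l : List E}
    (hne : translate Γ l t ≠ translate Γ l t')
    (hN : ∀ m, Γ.IsPathFrom y (l ++ m) → Γ.FixesStrongly (t.2.2⁻¹ * t'.2.2) (l ++ m) →
      Γ.FixesStrongly (t.2.2⁻¹ * t'.2.2) l) {k : List E} (hk : Γ.IsPathFrom y (l ++ k)) :
    ∃ m, Γ.IsPathFrom y (l ++ k ++ m) ∧
      Incomparable (translate Γ (l ++ k ++ m) t).2.1 (translate Γ (l ++ k ++ m) t').2.1 := by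
  by_cases h1 : t.2.1 <+: t'.2.1
  · have hr := ht.range_eq ht' h1
    obtain ⟨v, α, h⟩ := t
    obtain ⟨v', α', h'⟩ := t'
    obtain ⟨γ, hγ⟩ := h1
    change α ++ γ = α' at hγ
    change v = v' at hr
    subst hγ hr
    by_cases hγ : γ = []
    · subst hγ
      rw [List.append_nil] at *
      -- With equal paths, the translates by `l` coincide as soon as h⁻¹ h' strongly fixes `l`. As
      -- it does not, `hN` excludes all extensions of `l`, so some extension is moved; its images
      -- under h and h' are different lists of the same length, hence incomparable.
      have hnf : ¬ Γ.FixesStrongly (h⁻¹ * h') l := by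
        rintro ⟨h2, h3⟩
        refine hne ?_
        have h4 : h' = h * (h⁻¹ * h') := by group
        simp only [translate, Prod.mk.injEq, true_and]
        constructor
        · conv_rhs => rw [h4, actList_mul, h2]
        · conv_rhs => rw [h4, cocycleList_mul, h2, h3, mul_one]
      obtain ⟨m, hm, hmn⟩ := exists_actList_ne hslack hk (g := h⁻¹ * h') fun m hm hf =>
        hnf (hN (k ++ m) (by rwa [← List.append_assoc]) (by rwa [← List.append_assoc]))
      have hmn' : Γ.actList h (l ++ k ++ m) ≠ Γ.actList h' (l ++ k ++ m) := by
        intro heq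
        apply hmn
        rw [actList_mul, ← heq, ← actList_mul, inv_mul_cancel, actList_one]
      refine ⟨m, hm, ?_, ?_⟩
      · intro hp
        rw [translate, translate, List.prefix_append_right_inj] at hp
        exact hmn' (hp.eq_of_length (by simp only [length_actList]))
      · intro hp
        rw [translate, translate, List.prefix_append_right_inj] at hp
        exact hmn' (hp.eq_of_length (by simp only [length_actList])).symm
    · exact exists_incomparable_append hentry ht'.1 ht.2.1 ht'.2.1 hγ hk
  · by_cases h2 : t'.2.1 <+: t.2.1
    · have hr := ht'.range_eq ht h2
      obtain ⟨v, α, h⟩ := t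
      obtain ⟨v', α', h'⟩ := t'
      obtain ⟨γ, hγ⟩ := h2
      change α' ++ γ = α at hγ
      change v' = v at hr
      subst hγ hr
      have hγ : γ ≠ [] := by
        rintro rfl
        exact h1 (by simp)
      obtain ⟨m, hm, hi⟩ := exists_incomparable_append hentry ht.1 ht'.2.1 ht.2.1 hγ hk
      exact ⟨m, hm, hi.symm⟩
    · exact ⟨[], by simpa using hk, Incomparable.append ⟨h1, h2⟩ _ _⟩

/-- A finite family of properties of paths that persist under extensions and that can always be
achieved by an extension can be achieved simultaneously. -/
theorem exists_append_forall {ι : Type*} {y : V} {l : List E} (Q : ι → List E → Prop)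
    (T : Finset ι) (hl : Γ.IsPathFrom y l) (hmono : ∀ i l m, Q i l → Q i (l ++ m))
    (hex : ∀ i ∈ T, ∀ k, Γ.IsPathFrom y (l ++ k) →
      ∃ m, Γ.IsPathFrom y (l ++ k ++ m) ∧ Q i (l ++ k ++ m)) :
    ∃ m, Γ.IsPathFrom y (l ++ m) ∧ ∀ i ∈ T, Q i (l ++ m) := by
  classical
  induction T using Finset.induction_on with
  | empty => exact ⟨[], by simpa using hl, by simp⟩
  | insert i T _ ih =>
    obtain ⟨m, hm, h⟩ := ih fun j hj => hex j (Finset.mem_insert_of_mem hj)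
    obtain ⟨m', hm', h'⟩ := hex i (Finset.mem_insert_self _ _) m hm
    refine ⟨m ++ m', by rwa [← List.append_assoc], fun j hj => ?_⟩
    rw [← List.append_assoc]
    rcases Finset.mem_insert.1 hj with rfl | hj
    · exact h'
    · exact hmono _ _ _ (h j hj)

/-! ### Ideals -/

/-- Ideals of the ring are automatically closed under scalars: r a = (r e) a for a local unit e of
a. -/
theorem smul_mem_of_mem (I : TwoSidedIdeal (ExelPardoAlgebra R Γ)) (r : R)
    {a : ExelPardoAlgebra R Γ} (ha : a ∈ I) : r • a ∈ I := by
  obtain ⟨F, hF⟩ := exists_sum_p_mul a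
  rw [← hF F subset_rfl, ← smul_mul_assoc]
  exact I.mul_mem_left _ _ ha

variable (I : TwoSidedIdeal (ExelPardoAlgebra R Γ))

/-- The ideal `I` contains a nonzero combination of at most `n` elements `s_α u_g` with the same
domain. -/
def HasShortElement (n : ℕ) : Prop :=
  ∃ (y : V) (T : Finset (V × List E × G)) (c : V × List E × G → R),
    (∀ t ∈ T, IsTriple Γ y 1 t) ∧ ∑ t ∈ T, c t • tripleElem R Γ t ∈ I ∧
      ∑ t ∈ T, c t • tripleElem R Γ t ≠ 0 ∧ T.card = n

variable {I}

theorem exists_hasShortElement (hI : I ≠ ⊥) : ∃ n, HasShortElement I n := by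
  obtain ⟨a, haI, ha⟩ : ∃ a ∈ I, a ≠ 0 := by
    by_contra! h
    exact hI (eq_bot_iff.2 fun a ha => (TwoSidedIdeal.mem_bot _).2 (h a ha))
  obtain ⟨N, hN⟩ := exists_mul_pathElem_mem_tripleSpan a
  obtain ⟨v, hv⟩ := exists_mul_p_ne_zero ha
  -- Length N + 1 leaves at least one edge in every path of the expansion.
  obtain ⟨l, hl, hln, hne⟩ := exists_length_mul_pathElem_ne_zero hv (N + 1)
  have h1 := hN v l hl (by omega)
  rw [tripleSpan, Finsupp.mem_span_image_iff_linearCombination] at h1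
  obtain ⟨c, hc, hca⟩ := h1
  rw [Finsupp.linearCombination_apply, Finsupp.sum] at hca
  refine ⟨_, Γ.sourceFrom v l, c.support, c, fun t ht => ?_, ?_, ?_, rfl⟩
  · exact (hc ht : IsTriple Γ _ _ t).mono (by omega)
  · rw [hca]
    exact I.mul_mem_right _ _ haI
  · rwa [hca]

theorem exists_p_mem (hR : IsField R) (hfin : Γ.FinitelyManyMinimalStronglyFixed)
    (hentry : Γ.EveryCircuitHasEntry)
    (hslack : ∀ (v : V) (g : G), Γ.FixesCylinder g v → Γ.SlackAt g v) (hI : I ≠ ⊥) :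
    ∃ v, p R Γ v 1 ∈ I := by
  classical
  have hex := exists_hasShortElement hI
  obtain ⟨y, T, c, hT, hbI, hb0, hcard⟩ := Nat.find_spec hex
  have hmin := fun m => Nat.find_min (m := m) hex
  rw [← hcard] at hmin
  have hmul : ∀ l, Γ.IsPathFrom y l → (∑ t ∈ T, c t • tripleElem R Γ t) * pathElem R Γ y l 1 =
      ∑ t ∈ T, c t • tripleElem R Γ (translate Γ l t) := by
    intro l hl
    rw [Finset.sum_mul]
    refine Finset.sum_congr rfl fun t ht => ?_
    rw [smul_mul_assoc, tripleElem_mul_pathElem (hT t ht) hl]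
  have hc : ∀ t ∈ T, c t ≠ 0 := by
    intro t ht h0
    have hsum : ∑ t ∈ T.erase t, c t • tripleElem R Γ t = ∑ t ∈ T, c t • tripleElem R Γ t :=
      Finset.sum_erase _ (by rw [h0, zero_smul])
    refine hmin _ (Finset.card_erase_lt_of_mem ht) ⟨y, T.erase t, c, fun t' ht' =>
      hT t' (Finset.mem_of_mem_erase ht'), ?_, ?_, rfl⟩
    · rwa [hsum]
    · rwa [hsum]
  -- If two translates coincided, adding up their coefficients would give a nonzero element of `I`
  -- with fewer terms.
  have hinj : ∀ l, Γ.IsPathFrom y l →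
      (∑ t ∈ T, c t • tripleElem R Γ t) * pathElem R Γ y l 1 ≠ 0 →
      Set.InjOn (translate Γ l) T := by
    intro l hl hne
    by_contra hcon
    have hlt : (T.image (translate Γ l)).card < T.card :=
      lt_of_le_of_ne Finset.card_image_le fun h => hcon (Finset.card_image_iff.1 h)
    have hsum : ∑ t' ∈ T.image (translate Γ l), (∑ t ∈ T with translate Γ l t = t', c t) •
        tripleElem R Γ t' = (∑ t ∈ T, c t • tripleElem R Γ t) * pathElem R Γ y l 1 := by
      rw [hmul l hl]
      refine Eq.trans ?_ (Finset.sum_fiberwise_of_maps_to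
        (fun t ht => Finset.mem_image_of_mem (translate Γ l) ht) _)
      refine Finset.sum_congr rfl fun t' _ => ?_
      rw [Finset.sum_smul]
      refine Finset.sum_congr rfl fun t ht => ?_
      rw [(Finset.mem_filter.1 ht).2]
    refine hmin _ hlt ⟨Γ.sourceFrom y l, T.image (translate Γ l),
      fun t' => ∑ t ∈ T with translate Γ l t = t', c t, fun t' ht' => ?_, ?_, ?_, rfl⟩
    · obtain ⟨t, ht, rfl⟩ := Finset.mem_image.1 ht'
      exact (hT t ht).translate hl
    · rw [hsum]
      exact I.mul_mem_right _ _ hbI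
    · rwa [hsum]
  obtain ⟨t₁, ht₁⟩ : T.Nonempty := by
    rw [Finset.nonempty_iff_ne_empty]
    rintro rfl
    exact hb0 (by simp)
  -- These bounds depend only on the original group elements, so they can be fixed before `l` is
  -- chosen.
  choose N hN using fun t : V × List E × G => Γ.exists_length_fixesStrongly hfin
    (t₁.2.2⁻¹ * t.2.2) y
  have hb1 : (∑ t ∈ T, c t • tripleElem R Γ t) * p R Γ y 1 ≠ 0 := by
    change _ * pathElem R Γ y [] 1 ≠ 0
    rw [hmul [] trivial]
    simpa [translate, actList, cocycleList] using hb0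
  obtain ⟨l, hl, hln, hlne⟩ := exists_length_mul_pathElem_ne_zero hb1 (T.sup N)
  -- A nonzero product is needed only for `l`, to keep the triples distinct. For the extension by
  -- `m` incomparability is enough, since it yields a nonzero multiple of a vertex projection
  -- directly.
  obtain ⟨m, hm, hQ⟩ := exists_append_forall
    (fun t l => Incomparable (translate Γ l t₁).2.1 (translate Γ l t).2.1) (T.erase t₁) hl
    (fun t l m h => incomparable_translate_append h m) fun t ht k hk => by
      have ht' := Finset.mem_of_mem_erase ht
      refine exists_incomparable_translate hentry hslack (hT t₁ ht₁) (hT t ht') ?_ ?_ hk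
      · intro h
        exact Finset.ne_of_mem_erase ht (hinj l hl hlne ht₁ ht' h).symm
      · intro m hm hf
        exact hN t l m (by rw [hln]; exact Finset.le_sup ht') hm hf
  have key : star (tripleElem R Γ (translate Γ (l ++ m) t₁)) *
      ((∑ t ∈ T, c t • tripleElem R Γ t) * pathElem R Γ y (l ++ m) 1) ∈ I :=
    I.mul_mem_left _ _ (I.mul_mem_right _ _ hbI)
  rw [hmul _ hm, Finset.mul_sum, Finset.sum_eq_single_of_mem t₁ ht₁] at key
  · rw [mul_smul_comm, tripleElem, star_pathElem_mul_self _ ((hT t₁ ht₁).translate hm).1] at key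
    obtain ⟨d, hd⟩ := hR.mul_inv_cancel (hc t₁ ht₁)
    have := smul_mem_of_mem I d key
    rw [smul_smul, mul_comm, hd, one_smul] at this
    exact ⟨_, this⟩
  · intro t ht hne
    rw [mul_smul_comm, tripleElem, tripleElem, star_pathElem_mul_of_incomparable _ _
      ((hT t ht).translate hm).1 (hQ t (Finset.mem_erase.2 ⟨hne, ht⟩)), smul_zero]

theorem p_smul_mem {v : V} (g : G) (h : p R Γ v 1 ∈ I) : p R Γ (g • v) 1 ∈ I := by
  have h1 : p R Γ (g • v) g * p R Γ v 1 * p R Γ v g⁻¹ = p R Γ (g • v) 1 := by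
    rw [mul_assoc, p_one_mul_self, p_mul_p, if_pos rfl, mul_inv_cancel]
  rw [← h1]
  exact I.mul_mem_right _ _ (I.mul_mem_left _ _ h)

theorem p_source_mem {v : V} {l : List E} (hl : Γ.IsPathFrom v l) (h : p R Γ v 1 ∈ I) :
    p R Γ (Γ.sourceFrom v l) 1 ∈ I := by
  have h1 := star_pathElem_mul_self (R := R) (1 : G) hl
  rw [inv_one, one_smul] at h1
  rw [← h1, ← p_one_mul_pathElem (R := R) (1 : G) hl]
  exact I.mul_mem_left _ _ (I.mul_mem_right _ _ h)

/-- Since p_v = ∑ s_e p_{s(e)} s_e^*, a vertex projection outside `I` has an edge e into v whose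
source projection is also outside `I`. Iterating gives an infinite path that avoids `I`, while weak
transitivity joins y to it up to translation. -/
theorem forall_p_mem (htrans : Γ.WeaklyTransitive) {y : V} (hy : p R Γ y 1 ∈ I) (v : V) :
    p R Γ v 1 ∈ I := by
  by_contra hv
  obtain ⟨ξ, hξ, hn⟩ := InfPath.exists_forall_pre (Γ := Γ)
    (fun l => p R Γ (Γ.sourceFrom v l) 1 ∉ I) v hv fun l _ hl => by
      by_contra! h
      refine hl ?_
      rw [p_eq_sum]
      refine sum_mem fun e he => I.mul_mem_right _ _ ?_
      have h1 := h e (by simpa using he)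
      rw [sourceFrom_append] at h1
      rw [s_eq_mul]
      exact I.mul_mem_left _ _ h1
  obtain ⟨n, g, α, hα, hs⟩ := htrans ξ y
  refine hn n ?_
  rw [← hξ, InfPath.sourceFrom_pre, ← inv_smul_smul g (Γ.r (ξ.edge n)), ← hs]
  exact p_smul_mem _ (p_source_mem α.isPath (by rwa [hα]))

theorem eq_top_of_forall_p_mem (h : ∀ v, p R Γ v 1 ∈ I) : I = ⊤ := by
  rw [eq_top_iff]
  intro a _
  obtain ⟨F, hF⟩ := exists_sum_p_mul a
  rw [← hF F subset_rfl]
  exact I.mul_mem_right _ _ (sum_mem fun v _ => h v)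

theorem eq_bot_or_eq_top (hR : IsField R) (hfin : Γ.FinitelyManyMinimalStronglyFixed)
    (htrans : Γ.WeaklyTransitive) (hentry : Γ.EveryCircuitHasEntry)
    (hslack : ∀ (v : V) (g : G), Γ.FixesCylinder g v → Γ.SlackAt g v)
    (I : TwoSidedIdeal (ExelPardoAlgebra R Γ)) : I = ⊥ ∨ I = ⊤ := by
  by_cases hI : I = ⊥
  · exact .inl hI
  · obtain ⟨y, hy⟩ := exists_p_mem hR hfin hentry hslack hI
    exact .inr (eq_top_of_forall_p_mem (forall_p_mem htrans hy))

end ExelPardoAlgebra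

/-! ### Necessity: representations on functions on path-like sets. -/

namespace SelfSimilarGraph

variable {Γ : SelfSimilarGraph G V E}

/-! ### Sets of infinite-path-like objects -/

variable (Γ) in
/-- A set `X` whose elements have a range, a first edge and a tail and on which `G` acts, in the
same way as for infinite paths. -/
structure PathAction (X : Type*) where
  rg : X → V
  hd : X → E
  tl : X → X
  act : G → X → X
  r_hd : ∀ x, Γ.r (hd x) = rg x
  rg_tl : ∀ x, rg (tl x) = Γ.s (hd x)
  exists_cons : ∀ e x, rg x = Γ.s e → ∃ y, hd y = e ∧ tl y = x
  ext : ∀ x y, hd x = hd y → tl x = tl y → x = y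
  act_one : ∀ x, act 1 x = x
  act_mul : ∀ g h x, act (g * h) x = act g (act h x)
  hd_act : ∀ g x, hd (act g x) = g • hd x
  tl_act : ∀ g x, tl (act g x) = act (Γ.φ g (hd x)) (tl x)

namespace PathAction

variable {X : Type*} (A : Γ.PathAction X)

theorem rg_act (g : G) (x : X) : A.rg (A.act g x) = g • A.rg x := by
  rw [← A.r_hd, A.hd_act, Γ.r_smul, A.r_hd]

open Classical in
/-- The element with first edge `e` and tail `x`. -/
noncomputable def cons (e : E) (x : X) : X :=
  if h : A.rg x = Γ.s e then (A.exists_cons e x h).choose else x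

theorem hd_cons {e : E} {x : X} (h : A.rg x = Γ.s e) : A.hd (A.cons e x) = e := by
  rw [cons, dif_pos h]
  exact (A.exists_cons e x h).choose_spec.1

theorem tl_cons {e : E} {x : X} (h : A.rg x = Γ.s e) : A.tl (A.cons e x) = x := by
  rw [cons, dif_pos h]
  exact (A.exists_cons e x h).choose_spec.2

theorem rg_cons {e : E} {x : X} (h : A.rg x = Γ.s e) : A.rg (A.cons e x) = Γ.r e := by
  rw [← A.r_hd, A.hd_cons h]

theorem cons_hd_tl (x : X) : A.cons (A.hd x) (A.tl x) = x :=
  A.ext _ _ (A.hd_cons (A.rg_tl x)) (A.tl_cons (A.rg_tl x))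

theorem rg_act_φ {e : E} {x : X} (g : G) (h : A.rg x = Γ.s e) :
    A.rg (A.act (Γ.φ g e) x) = Γ.s (g • e) := by
  rw [rg_act, h, φ_smul_vertex, s_smul]

theorem act_cons {e : E} {x : X} (g : G) (h : A.rg x = Γ.s e) :
    A.act g (A.cons e x) = A.cons (g • e) (A.act (Γ.φ g e) x) := by
  refine A.ext _ _ ?_ ?_
  · rw [A.hd_act, A.hd_cons h, A.hd_cons (A.rg_act_φ g h)]
  · rw [A.tl_act, A.hd_cons h, A.tl_cons h, A.tl_cons (A.rg_act_φ g h)]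

/-! ### The operators on functions -/

variable (R : Type*) [CommRing R] (M : Type*) [AddCommGroup M] [Module R M]

open Classical in
/-- The operator of `p_{v,f}`. -/
noncomputable def opP (v : V) (f : G) : Module.End R (X → M) where
  toFun F x := if A.rg x = v then F (A.act f⁻¹ x) else 0
  map_add' F F' := by ext x; simp only [Pi.add_apply]; split_ifs <;> simp
  map_smul' c F := by ext x; simp

open Classical in
/-- The operator of `s_{e,g}`. -/
noncomputable def opS (e : E) (g : G) : Module.End R (X → M) where
  toFun F x := if A.hd x = e then F (A.act g⁻¹ (A.tl x)) else 0
  map_add' F F' := by ext x; simp only [Pi.add_apply]; split_ifs <;> simp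
  map_smul' c F := by ext x; simp

open Classical in
/-- The operator of `s_{e,g}^*`. -/
noncomputable def opS' (e : E) (g : G) : Module.End R (X → M) where
  toFun F x := if A.rg x = g⁻¹ • Γ.s e then F (A.cons e (A.act g x)) else 0
  map_add' F F' := by ext x; simp only [Pi.add_apply]; split_ifs <;> simp
  map_smul' c F := by ext x; simp

open Classical in
theorem opP_apply (v : V) (f : G) (F : X → M) (x : X) :
    A.opP R M v f F x = if A.rg x = v then F (A.act f⁻¹ x) else 0 := rfl

open Classical in
theorem opS_apply (e : E) (g : G) (F : X → M) (x : X) :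
    A.opS R M e g F x = if A.hd x = e then F (A.act g⁻¹ (A.tl x)) else 0 := rfl

open Classical in
theorem opS'_apply (e : E) (g : G) (F : X → M) (x : X) :
    A.opS' R M e g F x = if A.rg x = g⁻¹ • Γ.s e then F (A.cons e (A.act g x)) else 0 := rfl

open Classical in
theorem opP_mul_opP (v w : V) (f h : G) : A.opP R M v f * A.opP R M w h =
    if v = f • w then A.opP R M v (f * h) else 0 := by
  ext F x
  rw [Module.End.mul_apply, opP_apply, opP_apply, rg_act, inv_smul_eq_iff, ← A.act_mul,
    ← mul_inv_rev]
  by_cases h1 : A.rg x = v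
  · rw [if_pos h1, h1]
    by_cases h2 : v = f • w
    · rw [if_pos h2, if_pos h2, opP_apply, if_pos h1]
    · rw [if_neg h2, if_neg h2]; rfl
  · split_ifs <;> simp [opP_apply, h1]

open Classical in
theorem opP_mul_opS (v : V) (e : E) (f g : G) : A.opP R M v f * A.opS R M e g =
    if v = Γ.r (f • e) then A.opS R M (f • e) (Γ.φ f e * g) else 0 := by
  ext F x
  rw [Module.End.mul_apply, opP_apply, opS_apply, A.hd_act, inv_smul_eq_iff, A.tl_act]
  by_cases h2 : A.hd x = f • e
  · have h3 : Γ.φ f⁻¹ (f • e) = (Γ.φ f e)⁻¹ := by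
      rw [eq_inv_iff_mul_eq_one, ← φ_mul, inv_mul_cancel, φ_one]
    have h4 : A.rg x = Γ.r (f • e) := by rw [← h2, A.r_hd]
    rw [h2, if_pos rfl, h3, ← A.act_mul, ← mul_inv_rev, h4]
    by_cases h5 : v = Γ.r (f • e)
    · rw [if_pos h5.symm, if_pos h5, opS_apply, if_pos h2]
    · rw [if_neg (Ne.symm h5), if_neg h5]; rfl
  · rw [if_neg h2, ite_self]
    split_ifs
    · rw [opS_apply, if_neg h2]
    · rfl

open Classical in
theorem opS_mul_opP (e : E) (v : V) (g f : G) : A.opS R M e g * A.opP R M v f =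
    if g • v = Γ.s e then A.opS R M e (g * f) else 0 := by
  ext F x
  rw [Module.End.mul_apply, opS_apply, opP_apply, rg_act, inv_smul_eq_iff, ← A.act_mul,
    ← mul_inv_rev, A.rg_tl]
  by_cases h1 : A.hd x = e
  · subst h1
    by_cases h2 : g • v = Γ.s (A.hd x)
    · simp [h2, opS_apply]
    · simp [h2, Ne.symm h2]
  · split_ifs <;> simp [opS_apply, h1]

open Classical in
-- The adjoint of relation (d); `opP_mul_opS'` is the adjoint of relation (e).
theorem opS'_mul_opP (v : V) (e : E) (f g : G) :
    A.opS' R M e g * A.opP R M (f⁻¹ • v) f⁻¹ =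
      if v = Γ.r (f • e) then A.opS' R M (f • e) (Γ.φ f e * g) else 0 := by
  ext F x
  rw [Module.End.mul_apply, opS'_apply, opP_apply, inv_inv]
  have h3 : (Γ.φ f e * g)⁻¹ • Γ.s (f • e) = g⁻¹ • Γ.s e := by
    rw [s_smul, ← Γ.φ_smul_vertex f e, mul_inv_rev, mul_smul, inv_smul_smul]
  by_cases h1 : A.rg x = g⁻¹ • Γ.s e
  · have h2 : A.rg (A.act g x) = Γ.s e := by rw [rg_act, h1, smul_inv_smul]
    rw [if_pos h1, A.rg_cons h2, A.act_cons f h2, ← A.act_mul]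
    by_cases h5 : v = Γ.r (f • e)
    · rw [if_pos (by rw [h5, Γ.r_smul, inv_smul_smul]), if_pos h5, opS'_apply, h3, if_pos h1]
    · rw [if_neg (by rwa [eq_inv_smul_iff, ← Γ.r_smul, eq_comm]), if_neg h5]; rfl
  · rw [if_neg h1]
    split_ifs
    · rw [opS'_apply, h3, if_neg h1]
    · rfl

open Classical in
theorem opP_mul_opS' (e : E) (v : V) (g f : G) :
    A.opP R M (f⁻¹ • v) f⁻¹ * A.opS' R M e g =
      if g • v = Γ.s e then A.opS' R M e (g * f) else 0 := by
  ext F x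
  rw [Module.End.mul_apply, opP_apply, opS'_apply, inv_inv, rg_act, ← A.act_mul]
  by_cases h1 : g • v = Γ.s e
  · rw [if_pos h1, opS'_apply, mul_inv_rev, mul_smul, ← h1, inv_smul_smul]
    by_cases h2 : A.rg x = f⁻¹ • v
    · rw [if_pos h2, if_pos (by rw [h2, smul_inv_smul]), if_pos h2]
    · rw [if_neg h2, if_neg h2]
  · rw [if_neg h1]
    by_cases h2 : A.rg x = f⁻¹ • v
    · rw [if_pos h2, h2, smul_inv_smul, if_neg (by rwa [eq_inv_smul_iff])]; rfl
    · rw [if_neg h2]; rfl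

open Classical in
theorem opS'_mul_opS (e f : E) : A.opS' R M e 1 * A.opS R M f 1 =
    if e = f then A.opP R M (Γ.s e) 1 else 0 := by
  ext F x
  rw [Module.End.mul_apply, opS'_apply, opS_apply, A.act_one, inv_one, one_smul, A.act_one]
  by_cases h1 : A.rg x = Γ.s e
  · rw [A.hd_cons h1, A.tl_cons h1]
    split_ifs <;> simp [opP_apply, h1, A.act_one]
  · split_ifs <;> simp [opP_apply, h1]

/-- At a point x only the summand of its first edge survives, and it rebuilds x from its first edge
and its tail. -/
theorem opP_eq_sum (v : V) : A.opP R M v 1 =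
    ∑ e ∈ (Γ.finite_range_fiber v).toFinset, A.opS R M e 1 * A.opS' R M e 1 := by
  classical
  ext F x
  rw [LinearMap.sum_apply, Finset.sum_apply]
  simp only [Module.End.mul_apply, opP_apply, opS_apply, opS'_apply, inv_one, one_smul, A.act_one]
  rw [Finset.sum_ite_eq]
  simp [A.r_hd, A.rg_tl, A.cons_hd_tl]

/-! ### The representation -/

variable {R}

/-- The operator of a symbol. -/
noncomputable def symbOp : Symb G V E → Module.End R (X → M)
  | .P v f => A.opP R M v f
  | .S e g => A.opS R M e g
  | .Pstar v f => A.opP R M (f⁻¹ • v) f⁻¹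
  | .Sstar e g => A.opS' R M e g

variable (R) in
/-- The representation of the free `*`-algebra. -/
noncomputable def freeRep : FreeStarAlg R G V E →ₙₐ[R] Module.End R (X → M) :=
  MonoidAlgebra.liftMagma R (FreeSemigroup.lift (A.symbOp M))

theorem freeRep_single (a : Symb G V E) :
    A.freeRep R M (MonoidAlgebra.single (FreeSemigroup.of a) 1) = A.symbOp M a := by
  simp [freeRep]

theorem freeRep_P (v : V) (f : G) : A.freeRep R M (freeP R v f) = A.opP R M v f :=
  A.freeRep_single M (.P v f)

theorem freeRep_S (e : E) (g : G) : A.freeRep R M (freeS R e g) = A.opS R M e g :=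
  A.freeRep_single M (.S e g)

variable [StarRing R]

theorem freeRep_star_P (v : V) (f : G) :
    A.freeRep R M (star (freeP R v f)) = A.opP R M (f⁻¹ • v) f⁻¹ := by
  rw [freeP, star_single_of]
  exact A.freeRep_single M (.Pstar v f)

theorem freeRep_star_S (e : E) (g : G) :
    A.freeRep R M (star (freeS R e g)) = A.opS' R M e g := by
  rw [freeS, star_single_of]
  exact A.freeRep_single M (.Sstar e g)

/-- No involution is put on `Module.End R (X → M)`, so `existsUnique_lift` does not apply and each
relation is checked together with its adjoint. -/
theorem freeRep_eq {a b : FreeStarAlg R G V E} (h : Γ.GERel (freeP R) (freeS R) a b) :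
    A.freeRep R M a = A.freeRep R M b ∧ A.freeRep R M (star a) = A.freeRep R M (star b) := by
  classical
  have hite : ∀ (c : Prop) [Decidable c] (a : FreeStarAlg R G V E),
      star (if c then a else 0) = if c then star a else 0 := fun c _ a => by
    split_ifs <;> simp
  have hite' : ∀ (c : Prop) [Decidable c] (a : FreeStarAlg R G V E),
      A.freeRep R M (if c then a else 0) = if c then A.freeRep R M a else 0 := fun c _ a => by
    split_ifs <;> simp
  cases h with
  | proj_star v => simp [freeRep_P, freeRep_star_P]
  | proj_idem v => simp [freeRep_P, freeRep_star_P, opP_mul_opP]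
  | proj_orth v w h => simp [freeRep_P, freeRep_star_P, opP_mul_opP, h, h.symm]
  | partial_isometry e =>
    constructor
    · simp only [map_mul, freeRep_S, freeRep_star_S]
      rw [mul_assoc, opS'_mul_opS, if_pos rfl, opS_mul_opP, if_pos (one_smul _ _), one_mul]
    · simp only [star_mul, star_star, map_mul, freeRep_S, freeRep_star_S]
      rw [← mul_assoc, opS'_mul_opS, if_pos rfl]
      have := A.opP_mul_opS' R M e (Γ.s e) 1 1
      rwa [inv_one, one_smul, if_pos rfl, one_mul] at this
  | star_mul_edge e f =>
    constructor
    · simp only [map_mul, freeRep_S, freeRep_star_S, hite', freeRep_P, opS'_mul_opS]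
    · simp only [star_mul, star_star, map_mul, freeRep_S, freeRep_star_S, hite, hite',
        freeRep_star_P, opS'_mul_opS, inv_one, one_smul]
      by_cases h : e = f
      · subst h; simp
      · rw [if_neg h, if_neg (Ne.symm h)]
  | vertex_sum v =>
    constructor
    · simp only [map_sum, map_mul, freeRep_S, freeRep_star_S, freeRep_P, opP_eq_sum]
    · simp only [star_sum, star_mul, star_star, map_sum, map_mul, freeRep_S, freeRep_star_S,
        freeRep_star_P, inv_one, one_smul, opP_eq_sum]
  | star_vertex v f => simp [freeRep_P, freeRep_star_P]
  | vertex_vertex v w f h =>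
    constructor
    · simp only [map_mul, freeRep_P, hite', opP_mul_opP]
    · simp only [star_mul, map_mul, freeRep_star_P, hite, hite', opP_mul_opP]
      by_cases h1 : v = f • w
      · subst h1
        simp [mul_smul]
      · rw [if_neg h1, if_neg]
        rwa [smul_left_cancel_iff, eq_inv_smul_iff, eq_comm]
  | vertex_edge v e f g =>
    constructor
    · simp only [map_mul, freeRep_P, freeRep_S, hite', opP_mul_opS]
    · simp only [star_mul, map_mul, freeRep_star_P, freeRep_star_S, hite, hite', opS'_mul_opP]
  | edge_vertex e v g f =>
    constructor
    · simp only [map_mul, freeRep_P, freeRep_S, hite', opS_mul_opP]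
    · simp only [star_mul, map_mul, freeRep_star_P, freeRep_star_S, hite, hite', opP_mul_opS']

theorem freeRep_eq_zero {a : FreeStarAlg R G V E} (ha : a ∈ relatorIdeal R Γ) :
    A.freeRep R M a = 0 := by
  induction ha using TwoSidedIdeal.span_induction with
  | mem y hy =>
    obtain ⟨d, a, b, hab, rfl | rfl⟩ := hy
    · rw [map_smul, map_sub, (A.freeRep_eq M hab).1, sub_self, smul_zero]
    · rw [map_smul, star_sub, map_sub, (A.freeRep_eq M hab).2, sub_self, smul_zero]
  | zero => exact map_zero _
  | add a b _ _ ha hb => rw [map_add, ha, hb, add_zero]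
  | neg a _ ha => rw [map_neg, ha, neg_zero]
  | left_absorb b a _ ha => rw [map_mul, ha, mul_zero]
  | right_absorb b a _ ha => rw [map_mul, ha, zero_mul]

variable (R) in
/-- The representation of `L_R(G, E)` on the functions from `X` to `M`. -/
noncomputable def rep : ExelPardoAlgebra R Γ →ₙₐ[R] Module.End R (X → M) where
  toFun := Quotient.lift (fun a => A.freeRep R M a) fun a b hab => by
    have := A.freeRep_eq_zero M ((TwoSidedIdeal.rel_iff _ a b).1 hab)
    rwa [map_sub, sub_eq_zero] at this
  map_smul' c a := by
    obtain ⟨a, rfl⟩ := ExelPardoAlgebra.mk_surjective a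
    exact map_smul (A.freeRep R M) c a
  map_zero' := map_zero (A.freeRep R M)
  map_add' a b := by
    obtain ⟨a, rfl⟩ := ExelPardoAlgebra.mk_surjective a
    obtain ⟨b, rfl⟩ := ExelPardoAlgebra.mk_surjective b
    exact map_add (A.freeRep R M) a b
  map_mul' a b := by
    obtain ⟨a, rfl⟩ := ExelPardoAlgebra.mk_surjective a
    obtain ⟨b, rfl⟩ := ExelPardoAlgebra.mk_surjective b
    exact map_mul (A.freeRep R M) a b

open Classical in
theorem rep_p (v : V) (f : G) (F : X → M) (x : X) :
    A.rep R M (ExelPardoAlgebra.p R Γ v f) F x = if A.rg x = v then F (A.act f⁻¹ x) else 0 :=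
  congrFun (LinearMap.congr_fun (A.freeRep_P M v f) F) x

open Classical in
theorem rep_s (e : E) (g : G) (F : X → M) (x : X) :
    A.rep R M (ExelPardoAlgebra.s R Γ e g) F x =
      if A.hd x = e then F (A.act g⁻¹ (A.tl x)) else 0 :=
  congrFun (LinearMap.congr_fun (A.freeRep_S M e g) F) x

/-- The kernel is an ideal, and it is not everything: a nonzero constant function is not killed by
the projection at the range of a point. -/
theorem rep_injective [IsSimpleRing (ExelPardoAlgebra R Γ)] [Nonempty X] [Nontrivial M] :
    Function.Injective (A.rep R M) := by
  rcases eq_bot_or_eq_top (TwoSidedIdeal.ker (A.rep R M)) with h | h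
  · rwa [← TwoSidedIdeal.ker_eq_bot]
  · exfalso
    obtain ⟨x⟩ := ‹Nonempty X›
    obtain ⟨m, hm⟩ := exists_ne (0 : M)
    have h1 : ExelPardoAlgebra.p R Γ (A.rg x) 1 ∈ TwoSidedIdeal.ker (A.rep R M) := by
      rw [h]; trivial
    rw [TwoSidedIdeal.mem_ker] at h1
    have h2 := A.rep_p (R := R) M (A.rg x) 1 (fun _ => m) x
    rw [if_pos rfl, h1] at h2
    exact hm h2.symm

end PathAction
end SelfSimilarGraph

/-! ### Necessity: infinite paths, tail classes, decorated paths, and two facts about Z(v). -/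

namespace SelfSimilarGraph

variable {Γ : SelfSimilarGraph G V E}

namespace InfPath

theorem iterate_tail_act (g : G) (ξ : Γ.InfPath) (n : ℕ) :
    tail^[n] (ξ.act g) = (tail^[n] ξ).act (ξ.cocyclePrefix g n) := by
  induction n generalizing g ξ with
  | zero => rfl
  | succ n ih => rw [Function.iterate_succ_apply, tail_act, ih, cocyclePrefix_succ',
      Function.iterate_succ_apply]

theorem range_iterate_tail (ξ : Γ.InfPath) (n : ℕ) : (tail^[n] ξ).range = Γ.r (ξ.edge n) := by
  induction n generalizing ξ with
  | zero => rfl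
  | succ n ih => rw [Function.iterate_succ_apply, ih]; rfl

theorem pre_add (m n : ℕ) (ξ : Γ.InfPath) : ξ.pre (m + n) = ξ.pre m ++ (tail^[m] ξ).pre n := by
  induction m generalizing ξ with
  | zero => rw [Nat.zero_add]; rfl
  | succ m ih =>
    rw [Nat.succ_add, pre, ih, pre, List.cons_append, Function.iterate_succ_apply]

end InfPath

namespace PathAction

/-- The restriction to an invariant subset. -/
def restrict {X : Type*} (A : Γ.PathAction X) (S : Set X) (hact : ∀ g, ∀ x ∈ S, A.act g x ∈ S)
    (htl : ∀ x, A.tl x ∈ S ↔ x ∈ S) : Γ.PathAction S where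
  rg x := A.rg x
  hd x := A.hd x
  tl x := ⟨A.tl x, (htl _).2 x.2⟩
  act g x := ⟨A.act g x, hact g x x.2⟩
  r_hd x := A.r_hd x
  rg_tl x := A.rg_tl x
  exists_cons e x h := by
    obtain ⟨y, hy, hyx⟩ := A.exists_cons e x h
    exact ⟨⟨y, (htl y).1 (hyx ▸ x.2)⟩, hy, Subtype.ext hyx⟩
  ext x y h h' := Subtype.ext (A.ext _ _ h (congrArg Subtype.val h'))
  act_one x := Subtype.ext (A.act_one x)
  act_mul g h x := Subtype.ext (A.act_mul g h x)
  hd_act g x := A.hd_act g x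
  tl_act g x := Subtype.ext (A.tl_act g x)

variable (Γ) in
/-- The infinite paths. -/
def infPath : Γ.PathAction Γ.InfPath where
  rg := InfPath.range
  hd ξ := ξ.edge 0
  tl := InfPath.tail
  act g ξ := ξ.act g
  r_hd _ := rfl
  rg_tl := InfPath.range_tail
  exists_cons e ξ h := ⟨InfPath.cons e ξ h, rfl, rfl⟩
  ext ξ η h h' := InfPath.ext fun n => by
    cases n with
    | zero => exact h
    | succ n => exact congrArg (InfPath.edge · n) h'
  act_one := InfPath.act_one
  act_mul := InfPath.act_mul
  hd_act _ _ := rfl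
  tl_act := InfPath.tail_act

/-- The tail-equivalence class of `ξ` up to the action of `G`. -/
def orbit (ξ : Γ.InfPath) : Set Γ.InfPath :=
  {η | ∃ (m n : ℕ) (g : G), InfPath.tail^[m] η = (InfPath.tail^[n] ξ).act g}

/-- The class of `ξ`. -/
def ofOrbit (ξ : Γ.InfPath) : Γ.PathAction (orbit ξ) :=
  (infPath Γ).restrict (orbit ξ)
    (by
      rintro g η ⟨m, n, h, hη⟩
      refine ⟨m, n, η.cocyclePrefix g m * h, ?_⟩
      change InfPath.tail^[m] (η.act g) = _
      rw [InfPath.iterate_tail_act, hη, InfPath.act_mul])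
    (by
      intro η
      change η.tail ∈ _ ↔ _
      constructor
      · rintro ⟨m, n, h, hη⟩
        exact ⟨m + 1, n, h, hη⟩
      · rintro ⟨m, n, h, hη⟩
        refine ⟨m, n + 1, Γ.φ h ((InfPath.tail^[n] ξ).edge 0), ?_⟩
        rw [← Function.iterate_succ_apply, Function.iterate_succ_apply', hη, InfPath.tail_act,
          Function.iterate_succ_apply'])

open Filter in
variable (Γ) in
/-- The infinite paths, decorated by a degree and by the germ at infinity of a sequence in `G`. -/
def germ : Γ.PathAction (Γ.InfPath × ℤ × Germ (atTop : Filter ℕ) G) where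
  rg x := x.1.range
  hd x := x.1.edge 0
  tl x := (x.1.tail, x.2.1 - 1, x.2.2)
  -- The n-th entry is φ(g, ·) of the first n + d edges, d being the degree. Passing to the tail
  -- removes an edge and lowers d by one, so the same prefix is read; the truncation by `toNat`
  -- concerns finitely many n and is invisible to the germ.
  act g x := (x.1.act g, x.2.1,
    ((fun n : ℕ => x.1.cocyclePrefix g (n + x.2.1).toNat : ℕ → G) : Germ atTop G) * x.2.2)
  r_hd _ := rfl
  rg_tl x := x.1.range_tail
  exists_cons e x h := ⟨(InfPath.cons e x.1 h, x.2.1 + 1, x.2.2), rfl, by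
    ext1
    · rfl
    · simp⟩
  ext x y h h' := by
    simp only [Prod.mk.injEq, sub_left_inj] at h'
    exact Prod.ext ((infPath Γ).ext _ _ h h'.1) (Prod.ext h'.2.1 h'.2.2)
  act_one x := by
    simp only [InfPath.act_one, InfPath.cocyclePrefix_one]
    exact Prod.ext rfl (Prod.ext rfl (one_mul _))
  act_mul g h x := by
    simp only [InfPath.act_mul, InfPath.cocyclePrefix_mul]
    refine Prod.ext rfl (Prod.ext rfl ?_)
    rw [← mul_assoc, ← Germ.coe_mul]
    rfl
  hd_act _ _ := rfl
  tl_act g x := by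
    refine Prod.ext (InfPath.tail_act _ _) (Prod.ext rfl ?_)
    refine congrArg (· * x.2.2) (Germ.coe_eq.2 ?_)
    filter_upwards [eventually_ge_atTop (1 - x.2.1).toNat] with n hn
    have : ((n : ℤ) + x.2.1).toNat = ((n : ℤ) + (x.2.1 - 1)).toNat + 1 := by omega
    rw [this, InfPath.cocyclePrefix_succ']

section Starts

variable {X : Type*} (A : Γ.PathAction X)

/-- `x` starts with the path with range `v` and edges `l`. -/
def Starts : V → List E → X → Prop
  | v, [], x => A.rg x = v
  | _, e :: l, x => A.hd x = e ∧ Starts (Γ.s e) l (A.tl x)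

theorem starts_of_forall {v : V} {l : List E} {x : X} (hl : Γ.IsPathFrom v l)
    (h : ∀ e ∈ l, ∀ f, Γ.r f = Γ.r e → f = e) (hx : A.rg x = v) : A.Starts v l x := by
  induction l generalizing v x with
  | nil => exact hx
  | cons e l ih =>
    have h1 : A.hd x = e := h e (by simp) _ (by rw [A.r_hd, hx, hl.1])
    refine ⟨h1, ih hl.2 (fun e he => h e (by simp [he])) ?_⟩
    rw [A.rg_tl, h1]

theorem Starts.rg_eq {v : V} {l : List E} {x : X} (h : A.Starts v l x) (hl : Γ.IsPathFrom v l) :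
    A.rg x = v := by
  cases l with
  | nil => exact h
  | cons e l => rw [← A.r_hd, h.1, hl.1]

theorem Starts.rg_iterate {v : V} {l : List E} {x : X} (h : A.Starts v l x) :
    A.rg (A.tl^[l.length] x) = Γ.sourceFrom v l := by
  induction l generalizing v x with
  | nil => exact h
  | cons e l ih => exact ih h.2

theorem Starts.pre_eq {v : V} {l : List E} {ξ : Γ.InfPath} (h : (infPath Γ).Starts v l ξ) :
    ξ.pre l.length = l := by
  induction l generalizing v ξ with
  | nil => rfl
  | cons e l ih => exact congrArg₂ _ h.1 (ih h.2)

variable {R : Type*} [CommRing R] [StarRing R] (M : Type*) [AddCommGroup M] [Module R M]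

open Classical in
theorem rep_pathElem (v : V) (l : List E) (g : G) (F : X → M) (x : X) :
    A.rep R M (ExelPardoAlgebra.pathElem R Γ v l g) F x =
      if A.Starts v l x then F (A.act g⁻¹ (A.tl^[l.length] x)) else 0 := by
  induction l generalizing v x with
  | nil => exact A.rep_p M v g F x
  | cons e l ih =>
    rw [ExelPardoAlgebra.pathElem, map_mul, Module.End.mul_apply, rep_s, inv_one, A.act_one, ih]
    by_cases h : A.hd x = e <;> simp [h, Starts]

end Starts

end PathAction

/-- If the circuit `γ` has no entry, then there is only one infinite path with range `r(γ)`. -/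
theorem eq_of_circuit_without_entry {v : V} {g : G} {γ : List E} (hγ : Γ.IsPathFrom v γ)
    (hpos : 0 < γ.length) (hs : Γ.sourceFrom v γ = g • v)
    (h : ∀ e ∈ γ, ∀ f, Γ.r f = Γ.r e → f = e) {ξ η : Γ.InfPath} (hξ : ξ.range = v)
    (hη : η.range = v) : ξ = η := by
  have key : ∀ ξ : Γ.InfPath, ξ.range = v → ξ.pre γ.length = γ ∧
      ((InfPath.tail^[γ.length] ξ).act g⁻¹).range = v := by
    intro ξ hξ
    have h1 := (PathAction.infPath Γ).starts_of_forall hγ h hξ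
    refine ⟨h1.pre_eq, ?_⟩
    have h2 : (InfPath.tail^[γ.length] ξ).range = _ := h1.rg_iterate
    rw [InfPath.range_act, h2, hs, inv_smul_smul]
  refine InfPath.eq_of_pre fun n => ?_
  induction n generalizing ξ η with
  | zero => rfl
  | succ n ih =>
    -- Both paths start with γ, and their remainders, moved back by g⁻¹, lie in Z(v) again.
    -- Agreement of these on n edges gives agreement on |γ| + n ≥ n + 1 edges.
    obtain ⟨k, hk⟩ := Nat.exists_eq_add_of_lt hpos
    have h1 : ξ.pre (γ.length + n) = η.pre (γ.length + n) := by
      rw [InfPath.pre_add, InfPath.pre_add, (key ξ hξ).1, (key η hη).1]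
      have := ih (key ξ hξ).2 (key η hη).2
      rw [← InfPath.actList_pre, ← InfPath.actList_pre] at this
      rw [Γ.actList_injective _ this]
    rw [show γ.length + n = n + 1 + k by omega, InfPath.pre_add (n + 1) k ξ,
      InfPath.pre_add (n + 1) k η] at h1
    exact (List.append_inj h1 (by rw [InfPath.length_pre, InfPath.length_pre])).1

/-- By compactness of `Z(v)`, the element `g` is slack at `v` if every infinite path with range `v`
has a strongly fixed initial segment. -/
theorem slackAt_of_forall_exists {v : V} {g : G}
    (h : ∀ ξ : Γ.InfPath, ξ.range = v → ∃ n, Γ.FixesStrongly g (ξ.pre n)) : Γ.SlackAt g v := by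
  by_contra hcon
  -- The property carried along is that `l` has arbitrarily long extensions that are not strongly
  -- fixed; by row-finiteness it passes to some one-edge extension.
  obtain ⟨ξ, hξ, hQ⟩ := InfPath.exists_forall_pre (Γ := Γ) (fun l => ∀ n, ∃ m,
    Γ.IsPathFrom v (l ++ m) ∧ n ≤ (l ++ m).length ∧ ¬ Γ.FixesStrongly g (l ++ m)) v (by
      intro n
      by_contra! hn
      exact hcon ⟨n, fun α hα hαn => FinPath.stronglyFixedBy_iff.2
        (hn α.edges (hα ▸ α.isPath) hαn)⟩) (by
      intro l _ hl
      by_contra! hn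
      choose! N hN using hn
      -- The term l.length + 1 forces `m` to be nonempty, and the supremum exceeds the bound of
      -- whichever edge comes first.
      obtain ⟨m, hm, hlen, hf⟩ := hl
        (l.length + 1 + (Γ.finite_range_fiber (Γ.sourceFrom v l)).toFinset.sup N)
      cases m with
      | nil => simp at hlen; omega
      | cons e m =>
        have he : Γ.r e = Γ.sourceFrom v l := (Γ.isPathFrom_append.1 hm).2.1
        have hsup : N e ≤ (Γ.finite_range_fiber (Γ.sourceFrom v l)).toFinset.sup N :=
          Finset.le_sup (by simpa using he)
        rw [List.append_cons] at hm hlen hf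
        exact hf (hN e he m hm (by omega)))
  obtain ⟨n, hn⟩ := h ξ hξ
  obtain ⟨m, -, -, hm⟩ := hQ n 0
  exact hm (hn.append m)

end SelfSimilarGraph

/-! ### Necessity: simplicity of the algebra implies each condition. -/

namespace ExelPardoAlgebra

open SelfSimilarGraph

variable (R : Type x) [CommRing R] [StarRing R] (Γ : SelfSimilarGraph G V E)

theorem p_ne_zero [Nontrivial R] (v : V) : p R Γ v 1 ≠ 0 := by
  intro h
  obtain ⟨ξ, hξ⟩ := InfPath.exists_range_eq Γ v
  have h1 := (PathAction.infPath Γ).rep_p (R := R) R v 1 (fun _ => 1) ξ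
  rw [h, if_pos (show (PathAction.infPath Γ).rg ξ = v from hξ), map_zero] at h1
  exact zero_ne_one h1

variable {R Γ}

/-- For a nonzero nonunit r, the element r p_v acts as zero on functions with values in R/(r), so it
vanishes by faithfulness; on functions with values in `R` it multiplies by r at points of Z(v), so r
= 0. -/
theorem isField_of_isSimpleRing [Nonempty V] (hL : IsSimpleRing (ExelPardoAlgebra R Γ)) :
    IsField R := by
  obtain ⟨v⟩ := ‹Nonempty V›
  obtain ⟨ξ, hξ⟩ := InfPath.exists_range_eq Γ v
  have : Nonempty Γ.InfPath := ⟨ξ⟩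
  have hR : Nontrivial R := by
    by_contra h
    rw [not_nontrivial_iff_subsingleton] at h
    refine bot_ne_top (α := TwoSidedIdeal (ExelPardoAlgebra R Γ)) ?_
    rw [eq_comm, eq_bot_iff]
    intro a _
    rw [TwoSidedIdeal.mem_bot, ← one_smul R a, Subsingleton.elim (1 : R) 0, zero_smul]
  by_contra hf
  obtain ⟨r, hr, hru⟩ := Ring.exists_not_isUnit_of_not_isField hf
  have hM : Nontrivial (R ⧸ Ideal.span {r}) :=
    Ideal.Quotient.nontrivial_iff.2 (by rwa [Ne, Ideal.span_singleton_eq_top])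
  have h0 : r • p R Γ v 1 = 0 := by
    refine (PathAction.infPath Γ).rep_injective (R := R) (R ⧸ Ideal.span {r}) ?_
    rw [map_smul, map_zero]
    ext F x
    change r • (PathAction.infPath Γ).rep R (R ⧸ Ideal.span {r}) _ F x = 0
    generalize (PathAction.infPath Γ).rep R (R ⧸ Ideal.span {r}) _ F x = m
    obtain ⟨a, rfl⟩ := Ideal.Quotient.mk_surjective m
    change Ideal.Quotient.mk _ (r * a) = 0
    exact Ideal.Quotient.eq_zero_iff_mem.2
      (Ideal.mul_mem_right _ _ (Ideal.mem_span_singleton_self r))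
  have h1 := (PathAction.infPath Γ).rep_p (R := R) R v 1 (fun _ => 1) ξ
  rw [if_pos (show (PathAction.infPath Γ).rg ξ = v from hξ)] at h1
  have h2 := congrFun (LinearMap.congr_fun (congrArg ((PathAction.infPath Γ).rep R R) h0)
    (fun _ => 1)) ξ
  rw [map_smul, map_zero, LinearMap.smul_apply, Pi.smul_apply, h1, smul_eq_mul, mul_one] at h2
  exact hr h2

variable [Nontrivial R]

/-- If v cannot be joined to ξ up to translation, no path in the class of ξ has range v, so p_v acts
as zero on functions on that class. -/
theorem weaklyTransitive_of_isSimpleRing (hL : IsSimpleRing (ExelPardoAlgebra R Γ)) :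
    Γ.WeaklyTransitive := by
  intro ξ v
  have : Nonempty (PathAction.orbit ξ) :=
    ⟨⟨ξ, 0, 0, 1, by rw [InfPath.act_one]⟩⟩
  by_contra hcon
  have h0 : ∀ η ∈ PathAction.orbit ξ, η.range ≠ v := by
    rintro η ⟨m, n, g, h⟩ rfl
    refine hcon ⟨n, g, ⟨_, η.pre m, η.isPathFrom_pre m⟩, rfl, ?_⟩
    change Γ.sourceFrom _ _ = _
    rw [InfPath.sourceFrom_pre, ← InfPath.range_iterate_tail, h, InfPath.range_act,
      InfPath.range_iterate_tail]
  refine p_ne_zero R Γ v ((PathAction.ofOrbit ξ).rep_injective (R := R) R ?_)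
  ext F x
  rw [PathAction.rep_p, if_neg (show (PathAction.ofOrbit ξ).rg x ≠ v from h0 x x.2), map_zero]
  rfl

/-- Without an entry Z(v) is a single point, so s_γ u_g and p_v act alike on functions on E^∞ and
are equal. Yet on decorated paths s_γ u_g shifts the degree by |γ| > 0 and p_v does not. -/
theorem everyCircuitHasEntry_of_isSimpleRing (hL : IsSimpleRing (ExelPardoAlgebra R Γ)) :
    Γ.EveryCircuitHasEntry := by
  classical
  rintro g ⟨v, γ, hγ⟩ ⟨hpos, hs⟩
  by_contra hcon
  have h : ∀ e ∈ γ, ∀ f, Γ.r f = Γ.r e → f = e := by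
    intro e he f hf
    by_contra hne
    exact hcon ⟨e, he, f, hne, hf⟩
  change Γ.sourceFrom v γ = g • v at hs
  change 0 < γ.length at hpos
  obtain ⟨ξ, hξ⟩ := InfPath.exists_range_eq Γ v
  have : Nonempty Γ.InfPath := ⟨ξ⟩
  have heq : pathElem R Γ v γ g = p R Γ v 1 := by
    refine (PathAction.infPath Γ).rep_injective (R := R) R ?_
    ext F η
    rw [PathAction.rep_pathElem, PathAction.rep_p]
    by_cases hη : (PathAction.infPath Γ).rg η = v
    · have h1 := (PathAction.infPath Γ).starts_of_forall hγ h hη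
      rw [if_pos h1, if_pos hη, inv_one, PathAction.act_one]
      congr 1
      refine eq_of_circuit_without_entry hγ hpos hs h ?_ hη
      have h2 : (InfPath.tail^[γ.length] η).range = _ := h1.rg_iterate
      change ((InfPath.tail^[γ.length] η).act g⁻¹).range = v
      rw [InfPath.range_act, h2, hs, inv_smul_smul]
    · rw [if_neg hη, if_neg fun h1 => hη (h1.rg_eq _ hγ)]
  have hdeg : ∀ (n : ℕ) x, ((PathAction.germ Γ).tl^[n] x).2.1 = x.2.1 - n := by
    intro n
    induction n with
    | zero => simp
    | succ n ih =>
      intro x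
      rw [Function.iterate_succ_apply, ih]
      change x.2.1 - 1 - _ = _
      push_cast
      ring
  -- Both operators are applied to the indicator of degree 0 and evaluated at a point of degree 0
  -- over Z(v), giving 1 for p_v and 0 for s_γ u_g.
  have h1 := (PathAction.germ Γ).rep_p (R := R) R v 1 (fun x => if x.2.1 = 0 then 1 else 0)
    (ξ, 0, 1)
  have h2 := (PathAction.germ Γ).rep_pathElem (R := R) R v γ g
    (fun x => if x.2.1 = 0 then 1 else 0) (ξ, 0, 1)
  have hv : (PathAction.germ Γ).rg (ξ, 0, 1) = v := hξ
  rw [if_pos ((PathAction.germ Γ).starts_of_forall hγ h hv), heq, h1, if_pos hv] at h2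
  change (if (0 : ℤ) = 0 then (1 : R) else 0) =
    if ((PathAction.germ Γ).tl^[γ.length] (ξ, 0, 1)).2.1 = 0 then (1 : R) else 0 at h2
  rw [hdeg, if_pos rfl, if_neg (by simp only; omega)] at h2
  exact one_ne_zero h2

/-- Faithfulness on E^∞ gives p_{v,g} = p_{v,1}. On decorated paths p_{v,g} multiplies the germ by
the sequence φ(g⁻¹, ξ₁…ξₙ), which must therefore eventually be 1. So every ξ in Z(v) has a strongly
fixed prefix, and compactness gives slackness. -/
theorem slackAt_of_isSimpleRing (hL : IsSimpleRing (ExelPardoAlgebra R Γ))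
    {v : V} {g : G} (hg : Γ.FixesCylinder g v) : Γ.SlackAt g v := by
  classical
  obtain ⟨ξ₀, hξ₀⟩ := InfPath.exists_range_eq Γ v
  have : Nonempty Γ.InfPath := ⟨ξ₀⟩
  have hg' : ∀ ξ : Γ.InfPath, ξ.range = v → ξ.act g⁻¹ = ξ := fun ξ hξ => by
    have h := hg ξ hξ
    conv_lhs => rw [← h]
    rw [← InfPath.act_mul, inv_mul_cancel, InfPath.act_one]
  have heq : p R Γ v g = p R Γ v 1 := by
    refine (PathAction.infPath Γ).rep_injective (R := R) R ?_
    ext F η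
    rw [PathAction.rep_p, PathAction.rep_p, inv_one, PathAction.act_one]
    by_cases h : (PathAction.infPath Γ).rg η = v
    · rw [if_pos h, if_pos h]
      exact congrArg F (hg' η h)
    · rw [if_neg h, if_neg h]
  refine slackAt_of_forall_exists fun ξ hξ => ?_
  have h1 := (PathAction.germ Γ).rep_p (R := R) R v 1 (fun x => if x.2.2 = 1 then 1 else 0)
    (ξ, 0, 1)
  have h2 := (PathAction.germ Γ).rep_p (R := R) R v g (fun x => if x.2.2 = 1 then 1 else 0)
    (ξ, 0, 1)
  have hv : (PathAction.germ Γ).rg (ξ, 0, 1) = v := hξ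
  rw [heq, h1, if_pos hv, if_pos hv, inv_one, PathAction.act_one, if_pos rfl] at h2
  have h3 : (Filter.Germ.ofFun fun n : ℕ => ξ.cocyclePrefix g⁻¹ ((n : ℤ) + 0).toNat :
      Filter.Germ Filter.atTop G) * 1 = 1 := by
    by_contra hne
    exact one_ne_zero (h2.trans (if_neg hne))
  rw [mul_one] at h3
  obtain ⟨n, hn⟩ := (Filter.Germ.coe_eq.1 h3).exists
  have h4 : ξ.cocyclePrefix g⁻¹ n = 1 := by simpa using hn
  -- As g · ξ = ξ, the cocycle identity for g⁻¹ g transfers the triviality from g⁻¹ to g.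
  have h5 := InfPath.cocyclePrefix_mul g⁻¹ g ξ n
  rw [inv_mul_cancel, InfPath.cocyclePrefix_one, hg ξ hξ, h4, one_mul] at h5
  exact ⟨n, by rw [InfPath.actList_pre, hg ξ hξ], by rw [InfPath.cocycleList_pre, ← h5]⟩

end ExelPardoAlgebra

end ExelPardo

theorem mainTheorem11
    {G : Type*} {V : Type*} {E : Type*} [Group G] [MulAction G V] [MulAction G E]
    [Countable G] [Countable V] [Countable E] [Nonempty V]
    (Γ : ExelPardo.SelfSimilarGraph G V E)
    {R : Type*} [CommRing R] [StarRing R]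
    (hfin : Γ.FinitelyManyMinimalStronglyFixed) :
    IsSimpleRing (ExelPardo.ExelPardoAlgebra R Γ) ↔
      IsSimpleRing R ∧ Γ.WeaklyTransitive ∧ Γ.EveryCircuitHasEntry ∧
        ∀ (v : V) (g : G), Γ.FixesCylinder g v → Γ.SlackAt g v := by
  rw [isSimpleRing_iff_isField]
  constructor
  · intro hL
    have hR : IsField R := ExelPardo.ExelPardoAlgebra.isField_of_isSimpleRing hL
    have := hR.nontrivial
    exact ⟨hR, ExelPardo.ExelPardoAlgebra.weaklyTransitive_of_isSimpleRing hL,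
      ExelPardo.ExelPardoAlgebra.everyCircuitHasEntry_of_isSimpleRing hL,
      fun _ _ => ExelPardo.ExelPardoAlgebra.slackAt_of_isSimpleRing hL⟩
  · rintro ⟨hR, htrans, hentry, hslack⟩
    have := hR.nontrivial
    obtain ⟨v⟩ := ‹Nonempty V›
    have hne : Nontrivial (TwoSidedIdeal (ExelPardo.ExelPardoAlgebra R Γ)) := by
      refine ⟨⊥, ⊤, fun h => ExelPardo.ExelPardoAlgebra.p_ne_zero R Γ v ?_⟩
      rw [← TwoSidedIdeal.mem_bot, h]
      trivial
    exact ⟨{ eq_bot_or_eq_top :=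
      ExelPardo.ExelPardoAlgebra.eq_bot_or_eq_top hR hfin htrans hentry hslack }⟩
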